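/- Let $N\ge 3$, let $\mathbb F$ be a field with $\mathrm{char}(\mathbb F)\neq 2$, and let $q\in\mathbb F\setminus\{0\}$ be not a root of unity. Label the nodes of the Dynkin diagram of $\mathfrak{so}(2N)$ by $1,\dots,N$, so that $1-2-\cdots-(N-2)$ is a chain and $N-1$, $N$ are both joined to $N-2$; let $(a_{ij})$ be the Cartan matrix, $s_i$ the simple reflections and $h_{\alpha_i}$ the simple coroots. Let $U_q=U_q(\mathfrak{so}(2N))$ be the Drinfeld--Jimbo algebra over $\mathbb F$ with generators $E_i,F_i,K_i^{\pm1}$ ($1\le i\le N$), with $K_iE_jK_i^{-1}=q^{a_{ij}}E_j$, $K_iF_jK_i^{-1}=q^{-a_{ij}}F_j$, $[E_i,F_j]=\delta_{ij}\frac{K_i-K_i^{-1}}{q-q^{-1}}$, commuting $K_i$, and the quantum Serre relations, and with coproduct $\Delta(E_i)=E_i\otimes1+K_i\otimes E_i$, $\Delta(F_i)=F_i\otimes K_i^{-1}+1\otimes F_i$, $\Delta(K_i)=K_i\otimes K_i$. For $h=\sum_i n_ih_{\alpha_i}$ put $K_h=\prod_iK_i^{n_i}$. Let $T_i$ be the Lusztig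 automorphism of $U_q$ with $T_i(E_i)=-F_iK_i$, $T_i(F_i)=-K_i^{-1}E_i$, $T_i(K_h)=K_{s_i(h)}$, $T_i(E_j)=E_iE_j-q^{-1}E_jE_i$ and $T_i(F_j)=F_jF_i-qF_iF_j$ if $a_{ij}=-1$, and $T_i(E_j)=E_j$, $T_i(F_j)=F_j$ if $a_{ij}=0$. Let $w_X=\sigma_2\sigma_3\cdots\sigma_{N-1}$, with $\sigma_i=s_is_{i+1}\cdots s_{N-2}\,s_{N-1}s_N\,s_{N-2}\cdots s_{i+1}s_i$, be the longest element of the parabolic subgroup generated by $s_2,\dots,s_N$, and let $T_{w_X}$ be the corresponding product of the $T_i$. For $c_1\in\mathbb F\setminus\{0\}$ let $\mathcal B_{\mathbf c}\subset U_q$ be the subalgebra generated by $E_j,F_j,K_j^{\pm1}$ for $j=2,\dots,N$ and $B_1=F_1-c_1T_{w_X}(E_1)K_1^{-1}$. It satisfies $\Delta(\mathcal B_{\mathbf c})\subset\mathcal B_{\mathbf c}\otimes U_q$, so $V\otimes W$ is a $\mathcal B_{\mathbf c}$-module for every $\mathcal B_{\mathbf c}$-module $V$ and every $U_q$-module $W$.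 Let $Q^\vee_{2N-1}$ be the coroot lattice of $\mathfrak{so}(2N-1)$, with basis the simple coroots $h_{\gamma_1},\dots,h_{\gamma_{N-1}}$ ($\gamma_{N-1}$ the short simple root), let $P_{2N-1}=\mathrm{Hom}(Q^\vee_{2N-1},\mathbb Z)$, and let $\eta:Q^\vee_{2N-1}\to\bigoplus_i\mathbb Z h_{\alpha_i}$ be the homomorphism with $\eta(h_{\gamma_i})=h_{\alpha_{i+1}}$ for $1\le i\le N-2$ and $\eta(h_{\gamma_{N-1}})=h_{\alpha_N}-h_{\alpha_{N-1}}$. For a group homomorphism $\chi:Q^\vee_{2N-1}\to\{\pm1\}$, a finite-dimensional $\mathcal B_{\mathbf c}$-module $V$ is of type $\chi$ if $V=\bigoplus_{\lambda\in P_{2N-1}}V_{\lambda,\chi}$, where $V_{\lambda,\chi}=\{v\in V: K_{\eta(h)}v=\chi(h)q^{\lambda(h)}v\text{ for all }h\in Q^\vee_{2N-1}\}$. Let $\mathcal B_{\mathbf c}\text{-mod}_{f,\chi}$ be the category of finite-dimensional $\mathcal B_{\mathbf c}$-modules of type $\chi$, and let $\mathbf 1$ be the trivial homomorphism. Let $\mathbb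 F_\chi$ be the one-dimensional $U_q$-module on which all $E_i,F_i$ act by $0$, $K_1$ acts by $1$, and $K_{\eta(h)}$ acts by $\chi(h)$ for all $h\in Q^\vee_{2N-1}$. Then for every group homomorphism $\chi:Q^\vee_{2N-1}\to\{\pm1\}$ the functor $$\mathcal B_{\mathbf c}\text{-mod}_{f,\mathbf 1}\longrightarrow\mathcal B_{\mathbf c}\text{-mod}_{f,\chi},\qquad V\mapsto V\otimes\mathbb F_\chi,$$ is an equivalence of categories. -/

import Mathlib

namespace QSP
set_option linter.unusedSimpArgs false
section Identities
variable {𝕜 : Type*} [Field 𝕜] {R : Type*} [Ring R] [Algebra 𝕜 R]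

/-- The `p`-commutator `[x, y]_p = x y - p y x`. -/
def qComm (p : 𝕜) (x y : R) : R := x * y - p • (y * x)

/-- The expression `x² y - (q + q⁻¹) x y x + y x²`. -/
def serre (q : 𝕜) (x y : R) : R := x * x * y - (q + q⁻¹) • (x * y * x) + y * x * x

theorem serre_far {q : 𝕜} {x y z : R} (hxy : serre q z y = 0) (hxz : x * z = z * x) :
    serre q z (qComm q⁻¹ x y) = 0 := by
  unfold serre qComm at *
  have e1 : z * z * x = x * z * z := by rw [mul_assoc, ← hxz, ← mul_assoc, ← hxz]
  linear_combination (norm := (simp only [mul_sub, sub_mul, mul_add, add_mul, smul_mul_assoc, mul_smul_comm, smul_sub, smul_add, smul_smul, mul_assoc, mul_zero, zero_mul, smul_zero]; match_scalars <;> field_simp <;> ring))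
    x * hxy - q⁻¹ • (hxy * x) - hxz * (z * y) - z * hxz * y + (q+q⁻¹) • (hxz * (y * z)) - q⁻¹ • (y * hxz * z) - q⁻¹ • (y * z * hxz) + (q⁻¹ * (q + q⁻¹)) • (z * y * hxz)

theorem comm_adj {q : 𝕜} (hq : q ≠ 0) (ht : q ^ 2 + 1 ≠ 0) {x y z : R} (hxy : serre q x y = 0)
    (hxz : serre q x z = 0) (hyz : y * z = z * y) :
    qComm q⁻¹ x y * qComm q⁻¹ x z = qComm q⁻¹ x z * qComm q⁻¹ x y := by
  unfold serre qComm at *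
  linear_combination (norm := (simp only [mul_sub, sub_mul, mul_add, add_mul, smul_mul_assoc, mul_smul_comm, smul_sub, smul_add, smul_smul, mul_assoc, mul_zero, zero_mul, smul_zero]; match_scalars <;> field_simp <;> ring))
    (-(q + q⁻¹)⁻¹) • (hxy * z) + (q + q⁻¹)⁻¹ • (hxz * y)
    - (q⁻¹^2 * (q+q⁻¹)⁻¹) • (y * hxz) + (q⁻¹^2 * (q+q⁻¹)⁻¹) • (z * hxy)
    + (q + q⁻¹)⁻¹ • (x * x * hyz) - q⁻¹ • (x * hyz * x)
    + (q⁻¹^2 * (q+q⁻¹)⁻¹) • (hyz * (x * x))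

theorem serre_near {q : 𝕜} (hq : q ≠ 0) (ht : q ^ 2 + 1 ≠ 0) {x y z : R} (hxy : serre q x y = 0)
    (hyx : serre q y x = 0) (hyz : serre q y z = 0) (hxz : x * z = z * x) :
    serre q (qComm q⁻¹ x y) z = 0 := by
  unfold serre qComm at *
  linear_combination (norm := (simp only [mul_sub, sub_mul, mul_add, add_mul, smul_mul_assoc, mul_smul_comm, smul_sub, smul_add, smul_smul, mul_assoc, mul_zero, zero_mul, smul_zero]; match_scalars <;> field_simp <;> ring))
    (-(q⁻¹ + (q + q⁻¹)⁻¹)) • (hxz * (x * y * y)) + (q⁻¹ * (q + q⁻¹)) • (hxz * (y * x * y))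
    - (q + q⁻¹)⁻¹ • (x * hxz * (y * y)) + (q + q⁻¹) • (x * y * hxz * y)
    - (q⁻¹ + q⁻¹ ^ 2 * (q + q⁻¹)⁻¹) • (x * y * y * hxz) + q⁻¹ ^ 2 • (y * hxz * (x * y))
    - ((q + q⁻¹) * q⁻¹ ^ 2) • (y * hxz * (y * x)) - y * x * hxz * y
    + q⁻¹ ^ 2 • (y * x * y * hxz) + (q⁻¹ ^ 2 * (q + q⁻¹)⁻¹) • (y * y * hxz * x)
    - (q + q⁻¹)⁻¹ • (hxy * (y * z)) + hxy * (z * y)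
    - (q⁻¹ ^ 2 * (q + q⁻¹)⁻¹) • (y * hxy * z) + q⁻¹ ^ 2 • (y * z * hxy)
    - (q⁻¹ + (q + q⁻¹)⁻¹) • (z * hxy * y) + (q + q⁻¹)⁻¹ • (z * y * hxy)
    + (q⁻¹ ^ 2 * (q + q⁻¹)⁻¹) • (hyx * (x * z)) - (q⁻¹ ^ 2 * (q + q⁻¹)⁻¹) • (hyx * (z * x))
    + q⁻¹ • (x * z * hyx) - q⁻¹ • (z * hyx * x)
    + (q⁻¹ ^ 2 * (q + q⁻¹)⁻¹) • (hyz * (x * x)) - q⁻¹ • (x * hyz * x)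
    + (q + q⁻¹)⁻¹ • (x * x * hyz)

theorem serre_smul {q : 𝕜} {x y : R} (h : serre q x y = 0) (a b : 𝕜) :
    serre q (a • x) (b • y) = 0 := by
  have : serre q (a • x) (b • y) = (a * a * b) • serre q x y := by
    unfold serre
    simp only [smul_mul_assoc, mul_smul_comm, smul_sub, smul_add, smul_smul]
    match_scalars <;> ring
  rw [this, h, smul_zero]

theorem reassoc {a b r : R} (h : a * b = r) (c : R) : a * (b * c) = r * c := by
  rw [← mul_assoc, h]

theorem qComm_mul_f {q : 𝕜} (hq : q ≠ 0) (hd : q ^ 2 - 1 ≠ 0) {e f k k' y : R}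
    (hef : e * f - f * e = (q - q⁻¹)⁻¹ • (k - k'))
    (hky : k * y = q⁻¹ • (y * k)) (hky' : k' * y = q • (y * k')) (hfy : f * y = y * f) :
    qComm q⁻¹ e y * f = f * qComm q⁻¹ e y - y * k' := by
  unfold qComm
  have hef' : e * f = f * e + (q - q⁻¹)⁻¹ • (k - k') := by rw [← hef]; abel
  have hyf : y * f = f * y := hfy.symm
  simp only [mul_assoc, sub_mul, mul_sub, smul_mul_assoc, mul_smul_comm, hyf, hef', reassoc hef',
    mul_add, add_mul, hky, hky', reassoc hyf, smul_sub, smul_add, smul_smul]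
  match_scalars <;> field_simp <;> ring

theorem qComm_mul_y {q : 𝕜} (hq : q ≠ 0) {e y : R} (h : serre q y e = 0) :
    qComm q⁻¹ e y * y = q • (y * qComm q⁻¹ e y) := by
  unfold serre at h
  unfold qComm
  linear_combination (norm := (simp only [mul_sub, sub_mul, mul_add, add_mul, smul_mul_assoc, mul_smul_comm, smul_sub, smul_add, smul_smul, mul_assoc, mul_zero, zero_mul, smul_zero]; match_scalars <;> field_simp <;> ring)) h

theorem e_mul_qComm {q : 𝕜} (hq : q ≠ 0) {e y : R} (h : serre q e y = 0) :
    e * qComm q⁻¹ e y = q • (qComm q⁻¹ e y * e) := by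
  unfold serre at h
  unfold qComm
  linear_combination (norm := (simp only [mul_sub, sub_mul, mul_add, add_mul, smul_mul_assoc, mul_smul_comm, smul_sub, smul_add, smul_smul, mul_assoc, mul_zero, zero_mul, smul_zero]; match_scalars <;> field_simp <;> ring)) h

theorem serre_fk {q : 𝕜} (hq : q ≠ 0) (hd : q ^ 2 - 1 ≠ 0) {e f k k' y : R}
    (hk'k : k' * k = 1)
    (hke : k * e = q ^ 2 • (e * k)) (hk'e : k' * e = (q⁻¹ ^ 2) • (e * k'))
    (hkf : k * f = (q⁻¹ ^ 2) • (f * k))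
    (hef : e * f - f * e = (q - q⁻¹)⁻¹ • (k - k'))
    (hky : k * y = q⁻¹ • (y * k)) (hky' : k' * y = q • (y * k')) (hfy : f * y = y * f)
    (hye : serre q y e = 0) :
    serre q (f * k) (qComm q⁻¹ e y) = 0 ∧ serre q (qComm q⁻¹ e y) (f * k) = 0 := by
  have h1 := qComm_mul_f hq hd hef hky hky' hfy
  have h2 := qComm_mul_y hq hye
  have h3 : k * qComm q⁻¹ e y = q • (qComm q⁻¹ e y * k) := by
    unfold qComm
    simp only [mul_sub, sub_mul, smul_mul_assoc, mul_smul_comm, reassoc hke, reassoc hky, mul_assoc,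
      hke, hky, smul_sub, smul_smul]
    match_scalars <;> field_simp
  have h4 : k' * qComm q⁻¹ e y = q⁻¹ • (qComm q⁻¹ e y * k') := by
    unfold qComm
    simp only [mul_sub, sub_mul, smul_mul_assoc, mul_smul_comm, reassoc hk'e, reassoc hky', mul_assoc,
      hk'e, hky', smul_sub, smul_smul]
    match_scalars <;> field_simp
  generalize qComm q⁻¹ e y = w at h1 h2 h3 h4 ⊢
  have hyf : y * f = f * y := hfy.symm
  unfold serre
  constructor <;>
  · simp only [mul_sub, sub_mul, mul_add, add_mul, smul_mul_assoc, mul_smul_comm, mul_assoc,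
      h1, reassoc h1, h2, reassoc h2, h3, reassoc h3, h4, reassoc h4, hkf, reassoc hkf,
      hky, reassoc hky, hky', reassoc hky', hyf, reassoc hyf, hk'k,
      reassoc hk'k, smul_sub, smul_add, smul_smul, mul_one, one_mul]
    match_scalars <;> field_simp <;> ring

/-- Commutation of the images of `E_j` and `F_l` for two nodes adjacent to `i`. -/
theorem ef_adj {q : 𝕜} (hq : q ≠ 0) (hd : q ^ 2 - 1 ≠ 0) {e f k k' y g kl kl' : R}
    (hef : e * f - f * e = (q - q⁻¹)⁻¹ • (k - k'))
    (hky : k * y = q⁻¹ • (y * k)) (hky' : k' * y = q • (y * k'))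
    (hkg : k * g = q • (g * k)) (hkg' : k' * g = q⁻¹ • (g * k'))
    (hle : kl * e = q⁻¹ • (e * kl)) (hle' : kl' * e = q • (e * kl'))
    (hlf : kl * f = q • (f * kl)) (hlf' : kl' * f = q⁻¹ • (f * kl'))
    (hlk : kl * k = k * kl) (hlk' : kl * k' = k' * kl)
    (hl'k : kl' * k = k * kl') (hl'k' : kl' * k' = k' * kl')
    (hfy : f * y = y * f) (heg : e * g = g * e) (c : 𝕜)
    (hyg : y * g - g * y = c • (q - q⁻¹)⁻¹ • (kl - kl')) :
    qComm q⁻¹ e y * qComm q g f - qComm q g f * qComm q⁻¹ e y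
      = c • (q - q⁻¹)⁻¹ • (kl * k - kl' * k') := by
  have hef' : e * f = f * e + (q - q⁻¹)⁻¹ • (k - k') := by rw [← hef]; abel
  have hyg' : y * g = g * y + c • (q - q⁻¹)⁻¹ • (kl - kl') := by rw [← hyg]; abel
  have hyf : y * f = f * y := hfy.symm
  unfold qComm
  simp only [mul_sub, sub_mul, mul_add, add_mul, smul_mul_assoc, mul_smul_comm, mul_assoc,
      hef', reassoc hef', hyg', reassoc hyg', hky, reassoc hky, hky', reassoc hky', hkg, reassoc hkg,
      hkg', reassoc hkg', hle, reassoc hle, hle', reassoc hle', hlf, reassoc hlf, hlf', reassoc hlf',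
      hlk, reassoc hlk, hlk', reassoc hlk', hl'k, reassoc hl'k, hl'k', reassoc hl'k', hyf,
      reassoc hyf, heg, reassoc heg, smul_sub, smul_add, smul_smul]
  match_scalars <;> field_simp <;> ring

/-- Serre expressions of sums of `q`-commuting elements, as they occur for coproducts. -/
theorem serre_add {q : 𝕜} (hq : q ≠ 0) {x y x' y' : R} (hx : serre q x x' = 0)
    (hy : serre q y y' = 0) (h1 : y * x = q ^ 2 • (x * y)) (h2 : y * x' = q⁻¹ • (x' * y))
    (h3 : y' * x = q⁻¹ • (x * y')) : serre q (x + y) (x' + y') = 0 := by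
  have e : serre q (x + y) (x' + y') = serre q x x' + serre q y y' := by
    unfold serre
    simp only [mul_sub, sub_mul, mul_add, add_mul, smul_mul_assoc, mul_smul_comm, mul_assoc,
      h1, h2, h3, reassoc h1, reassoc h2, reassoc h3, smul_sub, smul_add, smul_smul]
    match_scalars <;> field_simp <;> ring
  rw [e, hx, hy, add_zero]

end Identities

/-! ### The quantised enveloping algebra of `so(2N)` -/

/-- A rank `N ≥ 3` and a nonzero element `q` of the field `𝕜` which is not a root of unity. -/
structure Params (𝕜 : Type*) [Field 𝕜] where
  N : ℕ
  three_le : 3 ≤ N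
  q : 𝕜
  q_ne_zero : q ≠ 0
  q_not_root : ∀ n : ℕ, 0 < n → q ^ n ≠ 1

/-- The generators `E_i, F_i, K_i, K_i⁻¹`. -/
inductive Gen (N : ℕ) : Type
  | E (i : Fin N) : Gen N
  | F (i : Fin N) : Gen N
  | K (i : Fin N) : Gen N
  | Kinv (i : Fin N) : Gen N

universe u
variable {𝕜 : Type u} [Field 𝕜]

/-- The Cartan matrix of `so(2N)`. The index `i : Fin N` is the node `i + 1` in the labelling
`1, …, N` in which `N - 1` and `N` are the two end nodes attached to `N - 2`. -/
abbrev Params.A (P : Params 𝕜) (i j : Fin P.N) : ℤ := CartanMatrix.D P.N i j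

/-- The defining relations of the Drinfeld-Jimbo algebra `U_q(so(2N))`. -/
inductive Rel (P : Params 𝕜) : FreeAlgebra 𝕜 (Gen P.N) → FreeAlgebra 𝕜 (Gen P.N) → Prop
  | K_Kinv (i) : Rel P (FreeAlgebra.ι 𝕜 (.K i) * FreeAlgebra.ι 𝕜 (.Kinv i)) 1
  | Kinv_K (i) : Rel P (FreeAlgebra.ι 𝕜 (.Kinv i) * FreeAlgebra.ι 𝕜 (.K i)) 1
  | K_K (i j) : Rel P (FreeAlgebra.ι 𝕜 (.K i) * FreeAlgebra.ι 𝕜 (.K j))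
      (FreeAlgebra.ι 𝕜 (.K j) * FreeAlgebra.ι 𝕜 (.K i))
  | K_E (i j) : Rel P
      (FreeAlgebra.ι 𝕜 (.K i) * FreeAlgebra.ι 𝕜 (.E j) * FreeAlgebra.ι 𝕜 (.Kinv i))
      (P.q ^ P.A i j • FreeAlgebra.ι 𝕜 (.E j))
  | K_F (i j) : Rel P
      (FreeAlgebra.ι 𝕜 (.K i) * FreeAlgebra.ι 𝕜 (.F j) * FreeAlgebra.ι 𝕜 (.Kinv i))
      (P.q ^ (-P.A i j) • FreeAlgebra.ι 𝕜 (.F j))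
  | E_F (i j) : Rel P
      (FreeAlgebra.ι 𝕜 (.E i) * FreeAlgebra.ι 𝕜 (.F j)
        - FreeAlgebra.ι 𝕜 (.F j) * FreeAlgebra.ι 𝕜 (.E i))
      (if i = j then
        (P.q - P.q⁻¹)⁻¹ • (FreeAlgebra.ι 𝕜 (.K i) - FreeAlgebra.ι 𝕜 (.Kinv i)) else 0)
  | E_comm (i j) (h : P.A i j = 0) : Rel P
      (FreeAlgebra.ι 𝕜 (.E i) * FreeAlgebra.ι 𝕜 (.E j))
      (FreeAlgebra.ι 𝕜 (.E j) * FreeAlgebra.ι 𝕜 (.E i))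
  | E_serre (i j) (h : P.A i j = -1) : Rel P
      (serre P.q (FreeAlgebra.ι 𝕜 (.E i)) (FreeAlgebra.ι 𝕜 (.E j))) 0
  | F_comm (i j) (h : P.A i j = 0) : Rel P
      (FreeAlgebra.ι 𝕜 (.F i) * FreeAlgebra.ι 𝕜 (.F j))
      (FreeAlgebra.ι 𝕜 (.F j) * FreeAlgebra.ι 𝕜 (.F i))
  | F_serre (i j) (h : P.A i j = -1) : Rel P
      (serre P.q (FreeAlgebra.ι 𝕜 (.F i)) (FreeAlgebra.ι 𝕜 (.F j))) 0

/-- The quantised enveloping algebra `U_q(so(2N))`. -/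
def Uq (P : Params 𝕜) : Type u := RingQuot (Rel P)

instance (P : Params 𝕜) : Ring (Uq P) := inferInstanceAs (Ring (RingQuot (Rel P)))
instance (P : Params 𝕜) : Algebra 𝕜 (Uq P) := inferInstanceAs (Algebra 𝕜 (RingQuot (Rel P)))

/-- The quotient map from the free algebra. -/
def Uq.mk (P : Params 𝕜) : FreeAlgebra 𝕜 (Gen P.N) →ₐ[𝕜] Uq P := RingQuot.mkAlgHom 𝕜 (Rel P)

/-- The generator `E_i`. -/
def E (P : Params 𝕜) (i : Fin P.N) : Uq P := Uq.mk P (FreeAlgebra.ι 𝕜 (.E i))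
/-- The generator `F_i`. -/
def F (P : Params 𝕜) (i : Fin P.N) : Uq P := Uq.mk P (FreeAlgebra.ι 𝕜 (.F i))
/-- The generator `K_i`. -/
def K (P : Params 𝕜) (i : Fin P.N) : Uq P := Uq.mk P (FreeAlgebra.ι 𝕜 (.K i))
/-- The generator `K_i⁻¹`. -/
def Kinv (P : Params 𝕜) (i : Fin P.N) : Uq P := Uq.mk P (FreeAlgebra.ι 𝕜 (.Kinv i))

/-- The families `e, f, k, k'` satisfy the defining relations. -/
structure IsRel (P : Params 𝕜) {R : Type*} [Ring R] [Algebra 𝕜 R] (e f k k' : Fin P.N → R) :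
    Prop where
  K_Kinv (i) : k i * k' i = 1
  Kinv_K (i) : k' i * k i = 1
  K_K (i j) : k i * k j = k j * k i
  K_E (i j) : k i * e j = P.q ^ P.A i j • (e j * k i)
  K_F (i j) : k i * f j = P.q ^ (-P.A i j) • (f j * k i)
  E_F (i j) : e i * f j - f j * e i =
    if i = j then (P.q - P.q⁻¹)⁻¹ • (k i - k' i) else 0
  E_comm (i j) (h : P.A i j = 0) : e i * e j = e j * e i
  E_serre (i j) (h : P.A i j = -1) : serre P.q (e i) (e j) = 0
  F_comm (i j) (h : P.A i j = 0) : f i * f j = f j * f i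
  F_serre (i j) (h : P.A i j = -1) : serre P.q (f i) (f j) = 0

theorem map_serre {R S : Type*} [Ring R] [Algebra 𝕜 R] [Ring S] [Algebra 𝕜 S] (φ : R →ₐ[𝕜] S)
    (q : 𝕜) (x y : R) : φ (serre q x y) = serre q (φ x) (φ y) := by
  simp [serre]

theorem map_qComm {R S : Type*} [Ring R] [Algebra 𝕜 R] [Ring S] [Algebra 𝕜 S] (φ : R →ₐ[𝕜] S)
    (q : 𝕜) (x y : R) : φ (qComm q x y) = qComm q (φ x) (φ y) := by
  simp [qComm]

/-- Families satisfying the defining relations give an algebra homomorphism. -/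
def Uq.lift (P : Params 𝕜) {R : Type*} [Ring R] [Algebra 𝕜 R] {e f k k' : Fin P.N → R}
    (h : IsRel P e f k k') : Uq P →ₐ[𝕜] R :=
  RingQuot.liftAlgHom 𝕜 ⟨FreeAlgebra.lift 𝕜 (fun g => match g with
    | .E i => e i
    | .F i => f i
    | .K i => k i
    | .Kinv i => k' i), by
      intro x y hxy
      induction hxy with
      | K_Kinv i => simpa using h.K_Kinv i
      | Kinv_K i => simpa using h.Kinv_K i
      | K_K i j => simpa using h.K_K i j
      | K_E i j => simp [h.K_E i j, mul_assoc (e j), h.K_Kinv, -mul_eq_mul_right_iff]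
      | K_F i j => simp [h.K_F i j, mul_assoc (f j), h.K_Kinv]
      | E_F i j =>
        have := h.E_F i j
        split_ifs at this ⊢ with hij <;> simpa using this
      | E_comm i j hij => simpa using h.E_comm i j hij
      | E_serre i j hij => simpa [map_serre] using h.E_serre i j hij
      | F_comm i j hij => simpa using h.F_comm i j hij
      | F_serre i j hij => simpa [map_serre] using h.F_serre i j hij⟩

section Lift
variable (P : Params 𝕜) {R : Type*} [Ring R] [Algebra 𝕜 R] {e f k k' : Fin P.N → R}
    (h : IsRel P e f k k')

theorem lift_mk (x) : Uq.lift P h (Uq.mk P x) = FreeAlgebra.lift 𝕜 (fun g => match g with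
    | .E i => e i
    | .F i => f i
    | .K i => k i
    | .Kinv i => k' i) x := RingQuot.liftAlgHom_mkAlgHom_apply ..
@[simp] theorem lift_E (i) : Uq.lift P h (E P i) = e i := by simp [E, lift_mk]
@[simp] theorem lift_F (i) : Uq.lift P h (F P i) = f i := by simp [F, lift_mk]
@[simp] theorem lift_K (i) : Uq.lift P h (K P i) = k i := by simp [K, lift_mk]
@[simp] theorem lift_Kinv (i) : Uq.lift P h (Kinv P i) = k' i := by simp [Kinv, lift_mk]
end Lift

theorem mk_rel (P : Params 𝕜) {x y} (h : Rel P x y) : Uq.mk P x = Uq.mk P y :=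
  RingQuot.mkAlgHom_rel 𝕜 h

theorem mul_eq_smul {R : Type*} [Ring R] [Algebra 𝕜 R] {k k' x : R} {r : 𝕜} (h1 : k' * k = 1)
    (h : k * x * k' = r • x) : k * x = r • (x * k) := by
  rw [← smul_mul_assoc, ← h, mul_assoc, h1, mul_one]

/-- The generators satisfy the defining relations. -/
theorem isRel (P : Params 𝕜) : IsRel P (E P) (F P) (K P) (Kinv P) where
  K_Kinv i := by simpa [K, Kinv] using mk_rel P (.K_Kinv i)
  Kinv_K i := by simpa [K, Kinv] using mk_rel P (.Kinv_K i)
  K_K i j := by simpa [K] using mk_rel P (.K_K i j)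
  K_E i j := mul_eq_smul (k' := Kinv P i) (by simpa [K, Kinv] using mk_rel P (.Kinv_K i))
    (by simpa [K, Kinv, E] using mk_rel P (.K_E i j))
  K_F i j := mul_eq_smul (k' := Kinv P i) (by simpa [K, Kinv] using mk_rel P (.Kinv_K i))
    (by simpa [K, Kinv, F] using mk_rel P (.K_F i j))
  E_F i j := by
    have := mk_rel P (.E_F i j)
    split_ifs at this ⊢ with h <;> simpa [E, F, K, Kinv] using this
  E_comm i j h := by simpa [E] using mk_rel P (.E_comm i j h)
  E_serre i j h := by simpa [E, map_serre] using mk_rel P (.E_serre i j h)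
  F_comm i j h := by simpa [F] using mk_rel P (.F_comm i j h)
  F_serre i j h := by simpa [F, map_serre] using mk_rel P (.F_serre i j h)

theorem A_symm (P : Params 𝕜) (i j : Fin P.N) : P.A i j = P.A j i :=
  (CartanMatrix.D_isSymm P.N).apply j i

theorem A_self (P : Params 𝕜) (i : Fin P.N) : P.A i i = 2 := by simp

theorem A_cases (P : Params 𝕜) (i j : Fin P.N) : i = j ∨ (i ≠ j ∧ P.A i j = -1) ∨
    (i ≠ j ∧ P.A i j = 0) := by
  by_cases h : i = j
  · exact .inl h
  · rcases CartanMatrix.isSimplyLaced_D P.N h with h' | h' <;> simp_all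

theorem A_adj_iff (P : Params 𝕜) (i j : Fin P.N) : P.A i j = -1 ↔
    (i.val + 1 = j.val ∧ j.val + 2 < P.N) ∨ (j.val + 1 = i.val ∧ i.val + 2 < P.N) ∨
    (i.val + 3 = P.N ∧ (j.val + 2 = P.N ∨ j.val + 1 = P.N)) ∨
    (j.val + 3 = P.N ∧ (i.val + 2 = P.N ∨ i.val + 1 = P.N)) := by
  have := P.three_le
  simp only [Params.A, CartanMatrix.D, Matrix.of_apply, Fin.ext_iff]
  split_ifs <;> simp <;> omega

theorem A_triangle (P : Params 𝕜) (i j k : Fin P.N) (h1 : P.A i j = -1) (h2 : P.A i k = -1) :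
    P.A j k ≠ -1 := by
  intro h
  rw [A_adj_iff] at h1 h2 h
  omega

theorem Params.sq_sub_ne (P : Params 𝕜) : P.q ^ 2 - 1 ≠ 0 :=
  sub_ne_zero.2 (P.q_not_root 2 (by norm_num))

theorem Params.sq_add_ne (P : Params 𝕜) : P.q ^ 2 + 1 ≠ 0 := by
  intro h
  apply P.q_not_root 4 (by norm_num)
  linear_combination (P.q ^ 2 - 1) * h

theorem inv_mul_eq_smul {R : Type*} [Ring R] [Algebra 𝕜 R] {k k' x : R} {r : 𝕜} (hr : r ≠ 0)
    (h1 : k * k' = 1) (h2 : k' * k = 1) (h : k * x = r • (x * k)) : k' * x = r⁻¹ • (x * k') := by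
  have : x * k' = r • (k' * x) := by
    calc x * k' = k' * (k * x) * k' := by rw [← mul_assoc, h2, one_mul]
      _ = r • (k' * x) := by
        rw [h, mul_smul_comm, smul_mul_assoc, mul_assoc, mul_assoc, h1, mul_one]
  rw [this, smul_smul, inv_mul_cancel₀ hr, one_smul]

theorem inv_comm {R : Type*} [Ring R] {k k' x : R} (h1 : k * k' = 1) (h2 : k' * k = 1)
    (h : k * x = x * k) : k' * x = x * k' := by
  calc k' * x = k' * (x * k) * k' := by rw [mul_assoc, mul_assoc, h1, mul_one]
    _ = x * k' := by rw [← h, ← mul_assoc, h2, one_mul]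

section IsRelLemmas
variable {P : Params 𝕜} {R : Type*} [Ring R] [Algebra 𝕜 R] {e f k k' : Fin P.N → R}

theorem IsRel.Kinv_E (h : IsRel P e f k k') (i j) :
    k' i * e j = P.q ^ (-P.A i j) • (e j * k' i) := by
  rw [zpow_neg]
  exact inv_mul_eq_smul (zpow_ne_zero _ P.q_ne_zero) (h.K_Kinv i) (h.Kinv_K i) (h.K_E i j)

theorem IsRel.Kinv_F (h : IsRel P e f k k') (i j) :
    k' i * f j = P.q ^ (P.A i j) • (f j * k' i) := by
  have := inv_mul_eq_smul (zpow_ne_zero _ P.q_ne_zero) (h.K_Kinv i) (h.Kinv_K i) (h.K_F i j)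
  rwa [← zpow_neg, neg_neg] at this

theorem IsRel.Kinv_K' (h : IsRel P e f k k') (i j) : k' i * k j = k j * k' i :=
  inv_comm (h.K_Kinv i) (h.Kinv_K i) (h.K_K i j)

theorem IsRel.Kinv_Kinv (h : IsRel P e f k k') (i j) : k' i * k' j = k' j * k' i :=
  inv_comm (h.K_Kinv i) (h.Kinv_K i) (h.Kinv_K' j i).symm

/-- The Chevalley involution. -/
theorem IsRel.flip (h : IsRel P e f k k') : IsRel P f e k' k where
  K_Kinv := h.Kinv_K
  Kinv_K := h.K_Kinv
  K_K := h.Kinv_Kinv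
  K_E := h.Kinv_F
  K_F := h.Kinv_E
  E_F i j := by
    have := h.E_F j i
    rw [← neg_inj, neg_sub, this]
    by_cases hij : i = j
    · subst hij; simp [← smul_neg]
    · simp [hij, Ne.symm hij]
  E_comm := h.F_comm
  E_serre := h.F_serre
  F_comm := h.E_comm
  F_serre := h.E_serre
end IsRelLemmas

/-! ### Coproduct -/

section Comul
open TensorProduct
variable (P : Params 𝕜)

theorem isRel_comul : IsRel P (R := Uq P ⊗[𝕜] Uq P)
    (fun i => E P i ⊗ₜ 1 + K P i ⊗ₜ E P i) (fun i => F P i ⊗ₜ Kinv P i + 1 ⊗ₜ F P i)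
    (fun i => K P i ⊗ₜ K P i) (fun i => Kinv P i ⊗ₜ Kinv P i) where
  K_Kinv i := by simp [(isRel P).K_Kinv, Algebra.TensorProduct.one_def]
  Kinv_K i := by simp [(isRel P).Kinv_K, Algebra.TensorProduct.one_def]
  K_K i j := by simp [(isRel P).K_K i j]
  K_E i j := by
    simp [mul_add, add_mul, (isRel P).K_E i j, (isRel P).K_K i j, smul_tmul']
  K_F i j := by
    simp [mul_add, add_mul, (isRel P).K_F i j, (isRel P).Kinv_K' j i, smul_tmul']
  E_F i j := by
    have h1 : E P i * F P j = F P j * E P i + (E P i * F P j - F P j * E P i) := by abel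
    rw [(isRel P).E_F] at h1
    have hq := zpow_ne_zero (P.A i j) P.q_ne_zero
    simp only [mul_add, add_mul, Algebra.TensorProduct.tmul_mul_tmul, one_mul, mul_one, h1,
      (isRel P).K_F i j, (isRel P).Kinv_E j i, (A_symm P j i), tmul_smul, ← smul_tmul',
      tmul_add, add_tmul, smul_smul, zpow_neg]
    by_cases hij : i = j
    · subst hij
      simp only [if_true, smul_sub, tmul_sub, sub_tmul, ← smul_tmul', tmul_smul]
      match_scalars <;> field_simp <;> ring
    · simp only [hij, if_false, tmul_zero, zero_tmul]
      match_scalars <;> field_simp <;> ring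
  E_comm i j h := by
    simp [mul_add, add_mul, (isRel P).E_comm i j h, (isRel P).K_E, h, A_symm P j i,
      (isRel P).K_K i j]
    abel
  E_serre i j h := by
    refine serre_add P.q_ne_zero ?_ ?_ ?_ ?_ ?_
    · have := congrArg (fun x => x ⊗ₜ[𝕜] (1 : Uq P)) ((isRel P).E_serre i j h)
      simpa [serre, add_tmul, sub_tmul, smul_tmul'] using this
    · have := congrArg (fun x => (K P i * K P i * K P j) ⊗ₜ[𝕜] x) ((isRel P).E_serre i j h)
      simpa [serre, tmul_add, tmul_sub, (isRel P).K_K j i, mul_assoc, reassoc ((isRel P).K_K j i)]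
        using this
    · simp [(isRel P).K_E, smul_tmul']
    · simp [(isRel P).K_E, h, smul_tmul']
    · simp [(isRel P).K_E, h, A_symm P j i, smul_tmul']
  F_comm i j h := by
    simp [mul_add, add_mul, (isRel P).F_comm i j h, (isRel P).Kinv_F, h, A_symm P j i,
      (isRel P).Kinv_Kinv i j]
    abel
  F_serre i j h := by
    rw [add_comm (F P i ⊗ₜ _), add_comm (F P j ⊗ₜ _)]
    refine serre_add P.q_ne_zero ?_ ?_ ?_ ?_ ?_
    · have := congrArg (fun x => (1 : Uq P) ⊗ₜ[𝕜] x) ((isRel P).F_serre i j h)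
      simpa [serre, tmul_add, tmul_sub] using this
    · have := congrArg (fun x => x ⊗ₜ[𝕜] (Kinv P i * Kinv P i * Kinv P j))
        ((isRel P).F_serre i j h)
      simpa [serre, add_tmul, sub_tmul, smul_tmul', (isRel P).Kinv_Kinv j i, mul_assoc,
        reassoc ((isRel P).Kinv_Kinv j i)] using this
    · simp [(isRel P).Kinv_F, smul_tmul']
    · simp [(isRel P).Kinv_F, h, smul_tmul']
    · simp [(isRel P).Kinv_F, h, A_symm P j i, smul_tmul']

/-- The coproduct `Δ(E_i) = E_i ⊗ 1 + K_i ⊗ E_i`, `Δ(F_i) = F_i ⊗ K_i⁻¹ + 1 ⊗ F_i`,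
`Δ(K_i) = K_i ⊗ K_i`. -/
def comul : Uq P →ₐ[𝕜] Uq P ⊗[𝕜] Uq P := Uq.lift P (isRel_comul P)

end Comul

/-! ### Lusztig's braid group operators -/

section Braid
variable {P : Params 𝕜} {R : Type*} [Ring R] [Algebra 𝕜 R] {e f k k' : Fin P.N → R}

/-- Up to nonzero scalars, the images of the `E_j` under the Lusztig operator for the node `i`. -/
def tE (P : Params 𝕜) {R : Type*} [Ring R] [Algebra 𝕜 R] (e f k : Fin P.N → R) (i j : Fin P.N) :
    R :=
  if j = i then f i * k i else if P.A i j = -1 then qComm P.q⁻¹ (e i) (e j) else e j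

theorem comm_qComm {p : 𝕜} {x y z : R} (hx : z * x = x * z) (hy : z * y = y * z) :
    z * qComm p x y = qComm p x y * z := by
  unfold qComm
  simp only [mul_sub, sub_mul, mul_smul_comm, smul_mul_assoc, reassoc hx, reassoc hy, mul_assoc,
    hx, hy]

theorem comm_mul {x y z : R} (hx : z * x = x * z) (hy : z * y = y * z) :
    z * (x * y) = x * y * z := by
  rw [← mul_assoc, hx, mul_assoc, hy, mul_assoc]

theorem IsRel.EF_ne (h : IsRel P e f k k') {i j} (hij : i ≠ j) : e i * f j = f j * e i := by
  have := h.E_F i j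
  rwa [if_neg hij, sub_eq_zero] at this

theorem IsRel.EF_self (h : IsRel P e f k k') (i) :
    e i * f i - f i * e i = (P.q - P.q⁻¹)⁻¹ • (k i - k' i) := by
  have := h.E_F i i
  rwa [if_pos rfl] at this

theorem IsRel.K_E_adj (h : IsRel P e f k k') {i j} (hij : P.A i j = -1) :
    k i * e j = P.q⁻¹ • (e j * k i) := by rw [h.K_E, hij, zpow_neg_one]

theorem IsRel.K_F_adj (h : IsRel P e f k k') {i j} (hij : P.A i j = -1) :
    k i * f j = P.q • (f j * k i) := by rw [h.K_F, hij, neg_neg, zpow_one]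

theorem IsRel.K_E_far (h : IsRel P e f k k') {i j} (hij : P.A i j = 0) :
    k i * e j = e j * k i := by rw [h.K_E, hij, zpow_zero, one_smul]

theorem IsRel.K_E_self (h : IsRel P e f k k') (i) :
    k i * e i = P.q ^ 2 • (e i * k i) := by rw [h.K_E, A_self]; norm_cast

theorem IsRel.K_F_self (h : IsRel P e f k k') (i) :
    k i * f i = P.q⁻¹ ^ 2 • (f i * k i) := by
  rw [h.K_F, A_self, zpow_neg, inv_pow]; norm_cast

theorem IsRel.tE_comm (h : IsRel P e f k k') (i j l : Fin P.N) (hjl : P.A j l = 0) :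
    tE P e f k i j * tE P e f k i l = tE P e f k i l * tE P e f k i j := by
  have hne : j ≠ l := by rintro rfl; simp at hjl
  wlog hw : ¬ (l = i) ∧ (P.A i l = -1 → P.A i j = -1) ∨ (j = i) generalizing j l
  · refine (this l j (by rw [A_symm, hjl]) hne.symm ?_).symm
    rcases A_cases P i j with h1 | h1 | h1 <;> rcases A_cases P i l with h2 | h2 | h2 <;> grind
  unfold tE
  rcases A_cases P i j with rfl | ⟨h1, h1'⟩ | ⟨h1, h1'⟩
  · -- `j = i`, so `l` is far from `i`
    rw [if_pos rfl, if_neg hne.symm, if_neg (by rw [hjl]; decide)]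
    exact (comm_mul (h.EF_ne hne.symm) (h.K_E_far hjl).symm).symm
  · rw [if_neg h1.symm, if_pos h1']
    have hli : l ≠ i := by
      rintro rfl
      rw [A_symm, h1'] at hjl
      exact absurd hjl (by decide)
    rw [if_neg hli]
    split_ifs with h2
    · exact comm_adj P.q_ne_zero P.sq_add_ne (h.E_serre _ _ h1') (h.E_serre _ _ h2)
        (h.E_comm _ _ hjl)
    · have h3 : P.A i l = 0 := by rcases A_cases P i l with h3 | h3 | h3 <;> grind
      exact (comm_qComm (h.E_comm _ _ h3).symm (h.E_comm _ _ hjl).symm).symm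
  · have hw' : l ≠ i ∧ (P.A i l = -1 → P.A i j = -1) := by grind
    have h2 : ¬ P.A i l = -1 := by
      intro h2
      have := hw'.2 h2
      omega
    rw [if_neg h1.symm, if_neg hw'.1, if_neg h2, if_neg (by rw [h1']; decide)]
    exact h.E_comm _ _ hjl

theorem IsRel.tE_serre (h : IsRel P e f k k') (i j l : Fin P.N) (hjl : P.A j l = -1) :
    serre P.q (tE P e f k i j) (tE P e f k i l) = 0 := by
  have hne : j ≠ l := by rintro rfl; simp at hjl
  have key (m : Fin P.N) (hm : P.A i m = -1) :=
    serre_fk P.q_ne_zero P.sq_sub_ne (h.Kinv_K i) (h.K_E_self i)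
      (by rw [h.flip.K_F_self]) (h.K_F_self i) (h.EF_self i)
      (h.K_E_adj hm) (h.flip.K_F_adj hm) (h.EF_ne (by rintro rfl; simp at hm)).symm
      (h.E_serre m i (by rw [A_symm, hm]))
  unfold tE
  rcases A_cases P i j with rfl | ⟨h1, h1'⟩ | ⟨h1, h1'⟩
  · rw [if_pos rfl, if_neg hne.symm, if_pos hjl]
    exact (key l hjl).1
  · rw [if_neg h1.symm, if_pos h1']
    by_cases hli : l = i
    · subst hli
      rw [if_pos rfl]
      exact (key j h1').2
    · have h2 : ¬ P.A i l = -1 := fun h2 => A_triangle P i j l h1' h2 hjl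
      rw [if_neg hli, if_neg h2]
      have h3 : P.A i l = 0 := by rcases A_cases P i l with h3 | h3 | h3 <;> grind
      exact serre_near P.q_ne_zero P.sq_add_ne (h.E_serre _ _ h1')
        (h.E_serre _ _ (by rw [A_symm, h1'])) (h.E_serre _ _ hjl) (h.E_comm _ _ h3)
  · have hli : l ≠ i := by
      rintro rfl
      rw [A_symm, h1'] at hjl
      exact absurd hjl (by decide)
    rw [if_neg h1.symm, if_neg hli, if_neg (by rw [h1']; decide)]
    split_ifs with h2
    · exact serre_far (h.E_serre _ _ hjl) (h.E_comm _ _ h1')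
    · exact h.E_serre _ _ hjl

variable (P)

/-- `T_i(E_j)`. -/
def TE (i j : Fin P.N) : Uq P :=
  if j = i then -(F P i * K P i)
  else if P.A i j = -1 then qComm P.q⁻¹ (E P i) (E P j) else E P j

/-- `T_i(F_j)`. -/
def TF (i j : Fin P.N) : Uq P :=
  if j = i then -(Kinv P i * E P i)
  else if P.A i j = -1 then qComm P.q (F P j) (F P i) else F P j

/-- `T_i(K_j)`. -/
def TK (i j : Fin P.N) : Uq P :=
  if j = i then Kinv P i else if P.A i j = -1 then K P j * K P i else K P j

/-- `T_i(K_j⁻¹)`. -/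
def TKinv (i j : Fin P.N) : Uq P :=
  if j = i then K P i else if P.A i j = -1 then Kinv P j * Kinv P i else Kinv P j

theorem TE_eq (i j : Fin P.N) :
    TE P i j = (if j = i then -1 else 1 : 𝕜) • tE P (E P) (F P) (K P) i j := by
  unfold TE tE
  split_ifs <;> simp

theorem TF_eq (i j : Fin P.N) :
    TF P i j = (if j = i then -(P.q⁻¹ ^ 2) else if P.A i j = -1 then -P.q else 1 : 𝕜) •
      tE P (F P) (E P) (Kinv P) i j := by
  unfold TF tE
  split_ifs
  · rw [(isRel P).flip.K_F_self, neg_smul]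
  · unfold qComm
    have := P.q_ne_zero
    match_scalars <;> field_simp
  · simp

/-- `x` has weight `μ`. -/
def HasWt (P : Params 𝕜) (x : Uq P) (μ : Fin P.N → ℤ) : Prop :=
  ∀ j, K P j * x = P.q ^ μ j • (x * K P j)

variable {P}

theorem HasWt.mul {x y : Uq P} {μ ν} (hx : HasWt P x μ) (hy : HasWt P y ν) :
    HasWt P (x * y) (fun j => μ j + ν j) := by
  intro j
  rw [← mul_assoc, hx j, smul_mul_assoc, mul_assoc, hy j, mul_smul_comm, smul_smul,
    ← zpow_add₀ P.q_ne_zero, mul_assoc]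

theorem HasWt.congr {x : Uq P} {μ ν} (hx : HasWt P x μ) (h : ∀ j, μ j = ν j) : HasWt P x ν := by
  intro j; rw [← h, hx j]

theorem HasWt.neg {x : Uq P} {μ} (hx : HasWt P x μ) : HasWt P (-x) μ := by
  intro j; rw [mul_neg, hx j, neg_mul, smul_neg]

theorem HasWt.sub {x y : Uq P} {μ} (hx : HasWt P x μ) (hy : HasWt P y μ) : HasWt P (x - y) μ := by
  intro j; rw [mul_sub, hx j, hy j, sub_mul, smul_sub]

theorem HasWt.smul {x : Uq P} {μ} (hx : HasWt P x μ) (c : 𝕜) : HasWt P (c • x) μ := by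
  intro j; rw [mul_smul_comm, hx j, smul_mul_assoc, smul_comm]

theorem HasWt.qComm {x y : Uq P} {μ ν} (hx : HasWt P x μ) (hy : HasWt P y ν) (p : 𝕜) :
    HasWt P (qComm p x y) (fun j => μ j + ν j) :=
  (hx.mul hy).sub (((hy.mul hx).congr fun _ => add_comm _ _).smul p)

theorem hasWt_E (j : Fin P.N) : HasWt P (E P j) (fun l => P.A l j) := fun l => (isRel P).K_E l j
theorem hasWt_F (j : Fin P.N) : HasWt P (F P j) (fun l => -P.A l j) := fun l => (isRel P).K_F l j
theorem hasWt_K (j : Fin P.N) : HasWt P (K P j) (fun _ => 0) := fun l => by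
  simp [(isRel P).K_K l j]
theorem hasWt_Kinv (j : Fin P.N) : HasWt P (Kinv P j) (fun _ => 0) := fun l => by
  simp [(isRel P).Kinv_K' j l]

theorem HasWt.Kinv {x : Uq P} {μ} (hx : HasWt P x μ) (j) :
    Kinv P j * x = P.q ^ (-μ j) • (x * Kinv P j) := by
  rw [zpow_neg]
  exact inv_mul_eq_smul (zpow_ne_zero _ P.q_ne_zero) ((isRel P).K_Kinv j) ((isRel P).Kinv_K j)
    (hx j)

theorem HasWt.TK {x : Uq P} {μ} (hx : HasWt P x μ) (i j) :
    TK P i j * x = P.q ^ (μ j - P.A i j * μ i) • (x * TK P i j) := by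
  unfold QSP.TK
  rcases A_cases P i j with rfl | ⟨h1, h1'⟩ | ⟨h1, h1'⟩
  · rw [if_pos rfl, hx.Kinv, A_self]
    congr 2; ring
  · rw [if_neg h1.symm, if_pos h1', mul_assoc, hx i, mul_smul_comm, ← mul_assoc, hx j,
      smul_mul_assoc, smul_smul, ← zpow_add₀ P.q_ne_zero, mul_assoc, h1']
    congr 2; ring
  · rw [if_neg h1.symm, if_neg (by rw [h1']; decide), hx j, h1']
    congr 2; ring

theorem hasWt_TE (i j : Fin P.N) :
    HasWt P (TE P i j) (fun l => P.A l j - P.A i j * P.A l i) := by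
  unfold TE
  rcases A_cases P i j with rfl | ⟨h1, h1'⟩ | ⟨h1, h1'⟩
  · rw [if_pos rfl]
    exact ((hasWt_F i).mul (hasWt_K i)).neg.congr fun l => by rw [A_self]; ring
  · rw [if_neg h1.symm, if_pos h1']
    exact ((hasWt_E i).qComm (hasWt_E j) _).congr fun l => by rw [h1']; ring
  · rw [if_neg h1.symm, if_neg (by rw [h1']; decide)]
    exact (hasWt_E j).congr fun l => by rw [h1']; ring

theorem hasWt_TF (i j : Fin P.N) :
    HasWt P (TF P i j) (fun l => -(P.A l j - P.A i j * P.A l i)) := by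
  unfold TF
  rcases A_cases P i j with rfl | ⟨h1, h1'⟩ | ⟨h1, h1'⟩
  · rw [if_pos rfl]
    exact ((hasWt_Kinv i).mul (hasWt_E i)).neg.congr fun l => by rw [A_self]; ring
  · rw [if_neg h1.symm, if_pos h1']
    exact ((hasWt_F j).qComm (hasWt_F i) _).congr fun l => by rw [h1']; ring
  · rw [if_neg h1.symm, if_neg (by rw [h1']; decide)]
    exact (hasWt_F j).congr fun l => by rw [h1']; ring

variable (P)

theorem isRel_T_EF (i j l : Fin P.N) : TE P i j * TF P i l - TF P i l * TE P i j =
    if j = l then (P.q - P.q⁻¹)⁻¹ • (TK P i j - TKinv P i j) else 0 := by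
  have h := isRel P
  have e1 (m : Fin P.N) (hm : P.A i m = -1) : (F P i * K P i) * qComm P.q (F P m) (F P i) =
      qComm P.q (F P m) (F P i) * (F P i * K P i) := by
    have hs := h.F_serre i m hm
    have hq := P.q_ne_zero
    unfold serre at hs
    unfold qComm
    have h1 := h.K_F_adj hm
    have h2 := h.K_F_self i
    linear_combination (norm := (
      simp only [mul_sub, sub_mul, mul_add, add_mul, smul_mul_assoc,
      mul_smul_comm, smul_sub, smul_add, smul_smul, mul_assoc, mul_zero, zero_mul, smul_zero, h1, h2,
      reassoc h1, reassoc h2]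
      match_scalars <;> field_simp <;> ring)) (-1 : 𝕜) • (hs * K P i)
  have e2 (m : Fin P.N) (hm : P.A i m = -1) : qComm P.q⁻¹ (E P i) (E P m) * (Kinv P i * E P i) =
      (Kinv P i * E P i) * qComm P.q⁻¹ (E P i) (E P m) := by
    have hs := h.E_serre i m hm
    have hq := P.q_ne_zero
    unfold serre at hs
    unfold qComm
    have h1 : E P m * Kinv P i = P.q⁻¹ • (Kinv P i * E P m) := by
      rw [h.flip.K_F_adj hm, smul_smul, inv_mul_cancel₀ hq, one_smul]
    have h2 : E P i * Kinv P i = P.q ^ 2 • (Kinv P i * E P i) := by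
      rw [h.flip.K_F_self i, smul_smul, ← mul_pow, mul_inv_cancel₀ hq, one_pow, one_smul]
    linear_combination (norm := (
      simp only [mul_sub, sub_mul, mul_add, add_mul, smul_mul_assoc,
      mul_smul_comm, smul_sub, smul_add, smul_smul, mul_assoc, mul_zero, zero_mul, smul_zero, h1, h2,
      reassoc h1, reassoc h2]
      match_scalars <;> field_simp <;> ring)) (-1 : 𝕜) • (Kinv P i * hs)
  have e3 (x y : Uq P) (h : x * y = y * x) : (-x) * y - y * (-x) = 0 := by
    rw [neg_mul, mul_neg, h, sub_self]
  have e4 (x y : Uq P) (h : x * y = y * x) : x * (-y) - (-y) * x = 0 := by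
    rw [neg_mul, mul_neg, h, sub_self]
  have f1 {m n : Fin P.N} (hmn : P.A m n = 0) : Kinv P m * F P n = F P n * Kinv P m :=
    h.flip.K_E_far hmn
  have f2 {m n : Fin P.N} (hmn : P.A m n = 0) : K P m * F P n = F P n * K P m :=
    inv_comm (h.Kinv_K m) (h.K_Kinv m) (f1 hmn)
  have f3 {m n : Fin P.N} (hmn : P.A m n = 0) : Kinv P m * E P n = E P n * Kinv P m :=
    inv_comm (h.K_Kinv m) (h.Kinv_K m) (h.K_E_far hmn)
  unfold TE TF TK TKinv
  rcases A_cases P i j with rfl | ⟨h1, h1'⟩ | ⟨h1, h1'⟩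
  · rw [if_pos rfl]
    by_cases hil : i = l
    · subst hil
      simp only [if_true]
      have a1 : F P i * K P i * (Kinv P i * E P i) = F P i * E P i := by
        rw [mul_assoc, reassoc (h.K_Kinv i), one_mul]
      have a2 : Kinv P i * E P i * (F P i * K P i) = E P i * F P i := by
        have hq := P.q_ne_zero
        rw [h.flip.K_F_self i, smul_mul_assoc, mul_assoc, reassoc (h.flip.K_E_self i),
          smul_mul_assoc, mul_smul_comm, smul_smul, mul_assoc, h.Kinv_K, mul_one, ← mul_pow,
          inv_mul_cancel₀ hq, one_pow, one_smul]
      rw [neg_mul_neg, neg_mul_neg, a1, a2, ← neg_sub, h.EF_self, ← smul_neg, neg_sub]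
    · rw [if_neg (Ne.symm hil), if_neg hil]
      split_ifs with h2
      · exact e3 _ _ (e1 l h2)
      · have h3 : P.A i l = 0 := by rcases A_cases P i l with h3 | h3 | h3 <;> grind
        exact e3 _ _ (comm_mul (h.F_comm _ _ h3).symm (f2 h3).symm).symm
  · simp only [if_neg h1.symm, if_pos h1']
    by_cases hil : l = i
    · subst hil
      rw [if_pos rfl, if_neg h1.symm]
      exact e4 _ _ (e2 j h1')
    · rw [if_neg hil]
      split_ifs with h2 h3 h3
      · subst h3
        have := ef_adj P.q_ne_zero P.sq_sub_ne (h.EF_self i) (h.K_E_adj h1') (h.flip.K_F_adj h1')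
          (h.K_F_adj h1') (h.flip.K_E_adj h1') (h.K_E_adj (by rw [A_symm, h1']))
          (h.flip.K_F_adj (by rw [A_symm, h1'])) (h.K_F_adj (by rw [A_symm, h1']))
          (h.flip.K_E_adj (by rw [A_symm, h1'])) (h.K_K j i) (h.Kinv_K' i j).symm (h.Kinv_K' j i)
          (h.Kinv_Kinv j i) (h.EF_ne h1.symm).symm (h.EF_ne h1) 1 (by rw [one_smul, h.EF_self j])
        rw [this, one_smul]
      · have := ef_adj P.q_ne_zero P.sq_sub_ne (h.EF_self i) (h.K_E_adj h1') (h.flip.K_F_adj h1')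
          (h.K_F_adj h2) (h.flip.K_E_adj h2) (h.K_E_adj (by rw [A_symm, h1']))
          (h.flip.K_F_adj (by rw [A_symm, h1'])) (h.K_F_adj (by rw [A_symm, h1']))
          (h.flip.K_E_adj (by rw [A_symm, h1'])) (h.K_K j i) (h.Kinv_K' i j).symm (h.Kinv_K' j i)
          (h.Kinv_Kinv j i) (h.EF_ne h1.symm).symm (h.EF_ne (Ne.symm hil)) 0
          (by rw [zero_smul, h.EF_ne h3, sub_self])
        rw [this, zero_smul]
      · subst h3; exact absurd h1' h2
      · rw [sub_eq_zero]
        exact (comm_qComm (h.EF_ne (Ne.symm hil)).symm (h.EF_ne h3).symm).symm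
  · have hn : ¬ P.A i j = -1 := by rw [h1']; decide
    simp only [if_neg h1.symm, if_neg hn]
    by_cases hil : l = i
    · subst hil
      rw [if_pos rfl, if_neg h1.symm]
      exact e4 _ _ (comm_mul (f3 h1').symm (h.E_comm _ _ h1').symm)
    · rw [if_neg hil]
      split_ifs with h2 h3 h3
      · subst h3; exact absurd h2 hn
      · rw [sub_eq_zero]
        exact comm_qComm (h.EF_ne h3) (h.EF_ne h1.symm)
      · subst h3; exact h.EF_self j
      · rw [sub_eq_zero]
        exact h.EF_ne h3

theorem isRel_T (i : Fin P.N) : IsRel P (TE P i) (TF P i) (TK P i) (TKinv P i) where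
  K_Kinv j := by
    have h := isRel P
    unfold TK TKinv
    split_ifs
    · exact h.Kinv_K i
    · rw [mul_assoc, reassoc (h.Kinv_K' j i).symm, mul_assoc, h.K_Kinv, mul_one, h.K_Kinv]
    · exact h.K_Kinv j
  Kinv_K j := by
    have h := isRel P
    unfold TK TKinv
    split_ifs
    · exact h.K_Kinv i
    · rw [mul_assoc, reassoc (h.Kinv_K' i j), mul_assoc, h.Kinv_K, mul_one, h.Kinv_K]
    · exact h.Kinv_K j
  K_K j l := by
    have h := isRel P
    have : HasWt P (TK P i l) (fun _ => 0) := by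
      unfold TK
      split_ifs
      · exact hasWt_Kinv i
      · exact ((hasWt_K l).mul (hasWt_K i)).congr fun _ => by simp
      · exact hasWt_K l
    rw [this.TK]
    simp
  K_E j l := by
    rw [(hasWt_TE i l).TK]
    congr 2
    rw [A_self, A_symm P j i]
    ring
  K_F j l := by
    rw [(hasWt_TF i l).TK]
    congr 2
    rw [A_self, A_symm P j i]
    ring
  E_F j l := isRel_T_EF P i j l
  E_comm j l h := by
    rw [TE_eq, TE_eq, smul_mul_smul_comm, smul_mul_smul_comm, (isRel P).tE_comm i j l h, mul_comm]
  E_serre j l h := by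
    rw [TE_eq, TE_eq]
    exact serre_smul ((isRel P).tE_serre i j l h) _ _
  F_comm j l h := by
    rw [TF_eq, TF_eq, smul_mul_smul_comm, smul_mul_smul_comm, (isRel P).flip.tE_comm i j l h,
      mul_comm]
  F_serre j l h := by
    rw [TF_eq, TF_eq]
    exact serre_smul ((isRel P).flip.tE_serre i j l h) _ _

/-- Lusztig's operator `T_i : U_q(so(2N)) → U_q(so(2N))`, with `T_i(E_i) = -F_i K_i`,
`T_i(F_i) = -K_i⁻¹ E_i`, `T_i(E_j) = [E_i, E_j]_{q⁻¹}`, `T_i(F_j) = [F_j, F_i]_q` for `j` adjacent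
to `i`, and `T_i(E_j) = E_j`, `T_i(F_j) = F_j` for the remaining `j`, and `T_i(K_h) = K_{s_i(h)}`. -/
def T (i : Fin P.N) : Uq P →ₐ[𝕜] Uq P := Uq.lift P (isRel_T P i)

end Braid

/-! ### The coideal subalgebra -/

section Coideal
open TensorProduct
variable (P : Params 𝕜)

/-- The node with label `k`, for `1 ≤ k ≤ N`. -/
def node (k : ℕ) : Fin P.N := ⟨(k - 1) % P.N, Nat.mod_lt _ (by have := P.three_le; omega)⟩

/-- The operator `T_{k₁} ∘ ⋯ ∘ T_{kᵣ}` for a word `k₁ ⋯ kᵣ` in the labels `1, …, N`. -/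
def Tword (w : List ℕ) : Uq P →ₐ[𝕜] Uq P :=
  w.foldr (fun k φ => (T P (node P k)).comp φ) (AlgHom.id 𝕜 (Uq P))

/-- The word `i, i+1, …, N-2, N-1, N, N-2, …, i+1, i`. -/
def sigmaWord (N i : ℕ) : List ℕ :=
  List.range' i (N - 1 - i) ++ [N - 1, N] ++ (List.range' i (N - 1 - i)).reverse

/-- The reduced expression `σ_2 σ_3 ⋯ σ_{N-1}` of the longest element of the parabolic subgroup
generated by `s_2, …, s_N`, where `σ_i` is given by `sigmaWord N i`. -/
def wXWord (N : ℕ) : List ℕ := (List.range' 2 (N - 2)).flatMap (sigmaWord N)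

/-- The set `E_j, F_j, K_j, K_j⁻¹` with `j` in `X = {2, …, N}`. -/
def MXgen : Set (Uq P) :=
  {x | ∃ j : Fin P.N, j.val ≠ 0 ∧ (x = E P j ∨ x = F P j ∨ x = K P j ∨ x = Kinv P j)}

/-- The subalgebra `M_X` of `U_q(so(2N))` generated by `E_j, F_j, K_j^{±1}` for `j = 2, …, N`. -/
def MX : Subalgebra 𝕜 (Uq P) := Algebra.adjoin 𝕜 (MXgen P)

/-- The element `B_1 = F_1 - c T_{w_X}(E_1) K_1⁻¹`. -/
def B1 (c : 𝕜) : Uq P :=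
  F P (node P 1) - c • (Tword P (wXWord P.N) (E P (node P 1)) * Kinv P (node P 1))

/-- The subalgebra `B_c` of `U_q(so(2N))` generated by `M_X` and `B_1`. -/
def Bc (c : 𝕜) : Subalgebra 𝕜 (Uq P) := Algebra.adjoin 𝕜 ((MX P : Set (Uq P)) ∪ {B1 P c})

variable {P}

theorem node_val {k : ℕ} (h1 : 1 ≤ k) (h2 : k ≤ P.N) : (node P k).val = k - 1 :=
  Nat.mod_eq_of_lt (by omega)

theorem A_val (i j : Fin P.N) : P.A i j = if i.val = j.val then 2 else if
    (i.val + 1 = j.val ∧ j.val + 2 < P.N) ∨ (j.val + 1 = i.val ∧ i.val + 2 < P.N) ∨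
    (i.val + 3 = P.N ∧ (j.val + 2 = P.N ∨ j.val + 1 = P.N)) ∨
    (j.val + 3 = P.N ∧ (i.val + 2 = P.N ∨ i.val + 1 = P.N)) then -1 else 0 := by
  by_cases h : i = j
  · subst h; simp
  · rw [if_neg (fun h' => h (Fin.ext h'))]
    split_ifs with h2
    · exact (A_adj_iff P i j).2 h2
    · rw [← A_adj_iff] at h2
      rcases A_cases P i j with h3 | h3 | h3 <;> grind

theorem Tword_cons (k : ℕ) (w : List ℕ) (x : Uq P) :
    Tword P (k :: w) x = T P (node P k) (Tword P w x) := rfl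

theorem Tword_nil (x : Uq P) : Tword P [] x = x := rfl

theorem Tword_append (v w : List ℕ) (x : Uq P) :
    Tword P (v ++ w) x = Tword P v (Tword P w x) := by
  induction v with
  | nil => rfl
  | cons k v ih => rw [List.cons_append, Tword_cons, ih, Tword_cons]

theorem T_self (i : Fin P.N) : T P i (E P i) = -(F P i * K P i) := by simp [T, TE]

theorem T_adj {i j : Fin P.N} (h : P.A i j = -1) :
    T P i (E P j) = qComm P.q⁻¹ (E P i) (E P j) := by
  have hne : j ≠ i := by rintro rfl; simp at h
  simp only [T, lift_E, TE]
  rw [if_neg hne, if_pos h]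

theorem T_far {i j : Fin P.N} (h : P.A i j = 0) : T P i (E P j) = E P j := by
  have hne : j ≠ i := by rintro rfl; simp at h
  simp only [T, lift_E, TE]
  rw [if_neg hne, if_neg (by rw [h]; decide)]

theorem T_braid {i j : Fin P.N} (h : P.A i j = -1) : T P i (T P j (E P i)) = E P j := by
  have h' := isRel P
  have hq := P.q_ne_zero
  have hne : j ≠ i := by rintro rfl; simp at h
  rw [T_adj (by rw [A_symm, h]), map_qComm, T_adj h, T_self]
  have h1 := qComm_mul_f hq P.sq_sub_ne (h'.EF_self i) (h'.K_E_adj h) (h'.flip.K_F_adj h)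
    (h'.EF_ne hne).symm
  have h3 : K P i * qComm P.q⁻¹ (E P i) (E P j) = P.q • (qComm P.q⁻¹ (E P i) (E P j) * K P i) := by
    rw [((hasWt_E i).qComm (hasWt_E j) _) i]
    beta_reduce
    rw [A_self, h]
    norm_num
  generalize qComm P.q⁻¹ (E P i) (E P j) = w at h1 h3 ⊢
  unfold qComm
  rw [mul_neg, ← mul_assoc, h1, sub_mul, mul_assoc (E P j), h'.Kinv_K, neg_mul,
    mul_assoc (F P i) (K P i), h3, mul_one, mul_smul_comm, smul_neg, smul_smul, inv_mul_cancel₀ hq, one_smul, mul_assoc]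
  abel

theorem qComm_assoc {p : 𝕜} {x y z : Uq P} (h : x * z = z * x) :
    qComm p (qComm p x y) z = qComm p x (qComm p y z) := by
  unfold qComm
  simp only [mul_sub, sub_mul, smul_mul_assoc, mul_smul_comm, mul_assoc, h, reassoc h, smul_sub,
    smul_smul]
  abel

/-- Iterated commutators `[E_{a₁}, [E_{a₂}, ⋯ [E_{aᵣ}, E_b] ⋯ ]]`. -/
def ch (L : List (Fin P.N)) (b : Fin P.N) : Uq P :=
  L.foldr (fun a x => qComm P.q⁻¹ (E P a) x) (E P b)

theorem ch_cons (a : Fin P.N) (L : List (Fin P.N)) (b : Fin P.N) :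
    ch (a :: L) b = qComm P.q⁻¹ (E P a) (ch L b) := rfl

theorem T_ch_far {a b : Fin P.N} {L : List (Fin P.N)} (hL : ∀ m ∈ L, P.A a m = 0)
    (hb : P.A a b = 0) : T P a (ch L b) = ch L b := by
  induction L with
  | nil => exact T_far hb
  | cons l L ih =>
    rw [ch_cons, map_qComm, T_far (hL l (by simp)), ih fun m hm => hL m (by simp [hm])]

theorem E_ch_far {a b : Fin P.N} {L : List (Fin P.N)} (hL : ∀ m ∈ L, P.A a m = 0)
    (hb : P.A a b = 0) : E P a * ch L b = ch L b * E P a := by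
  induction L with
  | nil => exact (isRel P).E_comm _ _ hb
  | cons l L ih =>
    rw [ch_cons]
    exact comm_qComm ((isRel P).E_comm _ _ (hL l (by simp))) (ih fun m hm => hL m (by simp [hm]))

theorem T_ch_step {a l b : Fin P.N} {L : List (Fin P.N)} (hl : P.A a l = -1)
    (hL : ∀ m ∈ L, P.A a m = 0) (hb : P.A a b = 0) :
    T P a (ch (l :: L) b) = qComm P.q⁻¹ (E P a) (ch (l :: L) b) := by
  rw [ch_cons, map_qComm, T_adj hl, T_ch_far hL hb, qComm_assoc (E_ch_far hL hb)]

variable (P)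

/-- The labels `m + 1, m, …, 2`. -/
def Yl : ℕ → List (Fin P.N)
  | 0 => []
  | m + 1 => node P (m + 2) :: Yl m

/-- The root vector for `ε_1 - ε_{m+2}`. -/
def Y (m : ℕ) : Uq P := ch (Yl P m) (node P 1)

/-- The labels `N - 1 - n, …, N - 2`. -/
def Ul : ℕ → List (Fin P.N)
  | 0 => []
  | n + 1 => node P (P.N - 2 - n) :: Ul n

/-- The root vector for `ε_1 + ε_{N-1-n}`. -/
def Z (n : ℕ) : Uq P := qComm P.q⁻¹ (ch (Ul P n) (node P P.N)) (Y P (P.N - 2))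

variable {P}

theorem mem_Yl {m : ℕ} {x : Fin P.N} (h : x ∈ Yl P m) :
    ∃ k, 2 ≤ k ∧ k ≤ m + 1 ∧ x = node P k := by
  induction m with
  | zero => simp [Yl] at h
  | succ m ih =>
    rcases List.mem_cons.1 h with rfl | h
    · exact ⟨m + 2, by omega, by omega, rfl⟩
    · obtain ⟨k, h1, h2, h3⟩ := ih h
      exact ⟨k, h1, by omega, h3⟩

theorem mem_Ul {n : ℕ} (hn : n + 3 ≤ P.N) {x : Fin P.N} (h : x ∈ Ul P n) :
    ∃ k, P.N - 1 - n ≤ k ∧ k ≤ P.N - 2 ∧ x = node P k := by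
  induction n with
  | zero => simp [Ul] at h
  | succ n ih =>
    rcases List.mem_cons.1 h with rfl | h
    · exact ⟨P.N - 2 - n, by omega, by omega, rfl⟩
    · obtain ⟨k, h1, h2, h3⟩ := ih (by omega) h
      exact ⟨k, by omega, h2, h3⟩

theorem A_node {k l : ℕ} (hk : 1 ≤ k) (hk' : k ≤ P.N) (hl : 1 ≤ l) (hl' : l ≤ P.N) :
    P.A (node P k) (node P l) = if k = l then 2 else if
    (k + 1 = l ∧ l < P.N) ∨ (l + 1 = k ∧ k < P.N) ∨ (k + 2 = P.N ∧ l = P.N) ∨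
      (l + 2 = P.N ∧ k = P.N) then -1 else 0 := by
  rw [A_val, node_val hk hk', node_val hl hl']
  have := P.three_le
  split_ifs <;> omega

theorem far_Yl {l m : ℕ} (hl : m + 3 ≤ l) (hl' : l ≤ P.N) (h : l = P.N → m + 4 ≤ l) :
    (∀ x ∈ Yl P m, P.A (node P l) x = 0) ∧ P.A (node P l) (node P 1) = 0 := by
  constructor
  · intro x hx
    obtain ⟨k, h1, h2, rfl⟩ := mem_Yl hx
    rw [A_node (by omega) hl' (by omega) (by omega), if_neg (by omega), if_neg (by omega)]
  · rw [A_node (by omega) hl' (by omega) (by omega), if_neg (by omega), if_neg (by omega)]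

theorem T_Y {l m : ℕ} (hl' : l ≤ P.N)
    (h : l = m + 2 ∧ l < P.N ∨ l = P.N ∧ m + 3 = P.N) :
    T P (node P l) (Y P m) = qComm P.q⁻¹ (E P (node P l)) (Y P m) := by
  cases m with
  | zero =>
    apply T_adj
    rw [A_node (by omega) hl' (by omega) (by omega), if_neg (by omega), if_pos (by omega)]
  | succ m =>
    have hf := far_Yl (P := P) (l := l) (m := m) (by omega) hl' (by omega)
    refine T_ch_step ?_ hf.1 hf.2
    rw [A_node (by omega) hl' (by omega) (by omega), if_neg (by omega), if_pos (by omega)]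

theorem T_Y_succ {m : ℕ} (h : m + 2 < P.N) : T P (node P (m + 2)) (Y P m) = Y P (m + 1) :=
  T_Y h.le (.inl ⟨rfl, h⟩)

/-- `E_l` commutes with, and `T_l` fixes, the root vector for `ε_1 - ε_{k+1}` if `2 ≤ l < k`. -/
theorem inner_Y {l m : ℕ} (hl : 2 ≤ l) (hlm : l ≤ m) (hm : m + 1 < P.N) :
    E P (node P l) * Y P m = Y P m * E P (node P l) ∧ T P (node P l) (Y P m) = Y P m := by
  induction m, hlm using Nat.le_induction with
  | base =>
    obtain ⟨l, rfl⟩ : ∃ l', l = l' + 2 := ⟨l - 2, by omega⟩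
    have hf := far_Yl (P := P) (l := l + 3) (m := l) (by omega) (by omega) (by omega)
    have hadj : P.A (node P (l + 3)) (node P (l + 2)) = -1 := by
      rw [A_node (by omega) (by omega) (by omega) (by omega), if_neg (by omega), if_pos (by omega)]
    have e1 : Y P (l + 2) = T P (node P (l + 3)) (T P (node P (l + 2)) (Y P l)) := by
      rw [T_Y_succ (by omega), T_Y_succ (by omega)]
    constructor
    · have e2 := T_braid hadj
      rw [e1, ← e2, ← map_mul, ← map_mul, ← map_mul, ← map_mul]
      exact congrArg _ (congrArg _ (E_ch_far hf.1 hf.2))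
    · have e3 : Y P (l + 2) =
          qComm P.q⁻¹ (T P (node P (l + 3)) (E P (node P (l + 2)))) (Y P l) := by
        rw [T_adj hadj, qComm_assoc (z := Y P l) (E_ch_far hf.1 hf.2)]
        rfl
      conv_lhs => rw [e3]
      rw [map_qComm, T_braid (by rw [A_symm, hadj]), T_Y_succ (by omega)]
      rfl
  | succ m hlm ih =>
    have ih := ih (by omega)
    have hA : P.A (node P l) (node P (m + 2)) = 0 := by
      rw [A_node (by omega) (by omega) (by omega) (by omega), if_neg (by omega), if_neg (by omega)]
    have e1 : Y P (m + 1) = qComm P.q⁻¹ (E P (node P (m + 2))) (Y P m) := rfl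
    constructor
    · rw [e1]; exact comm_qComm ((isRel P).E_comm _ _ hA) ih.1
    · rw [e1, map_qComm, T_far hA, ih.2]

theorem T_U {n : ℕ} (hn : n + 4 ≤ P.N) :
    T P (node P (P.N - 2 - n)) (ch (Ul P n) (node P P.N)) = ch (Ul P (n + 1)) (node P P.N) := by
  cases n with
  | zero =>
    apply T_adj
    rw [A_node (by omega) (by omega) (by omega) (by omega), if_neg (by omega), if_pos (by omega)]
  | succ n =>
    refine T_ch_step ?_ ?_ ?_
    · rw [A_node (by omega) (by omega) (by omega) (by omega), if_neg (by omega), if_pos (by omega)]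
    · intro x hx
      obtain ⟨k, h1, h2, rfl⟩ := mem_Ul (by omega) hx
      rw [A_node (by omega) (by omega) (by omega) (by omega), if_neg (by omega), if_neg (by omega)]
    · rw [A_node (by omega) (by omega) (by omega) (by omega), if_neg (by omega), if_neg (by omega)]

theorem Z_succ {n : ℕ} (hn : n + 4 ≤ P.N) :
    Z P (n + 1) = qComm P.q⁻¹ (E P (node P (P.N - 2 - n))) (Z P n) :=
  qComm_assoc (inner_Y (by omega) (by omega) (by omega)).1

theorem T_Z {n : ℕ} (hn : n + 4 ≤ P.N) : T P (node P (P.N - 2 - n)) (Z P n) = Z P (n + 1) := by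
  rw [Z, map_qComm, T_U hn, (inner_Y (by omega) (by omega) (by omega)).2]
  rfl

theorem Tword_down {m : ℕ} (hm : m + 1 < P.N) :
    Tword P (List.range' 2 m).reverse (E P (node P 1)) = Y P m := by
  induction m with
  | zero => rfl
  | succ m ih =>
    rw [List.range'_concat, List.reverse_append, List.reverse_singleton, List.singleton_append,
      Tword_cons, ih (by omega), ← T_Y_succ (by omega)]
    congr 3; omega

theorem Tword_up {n : ℕ} (hn : n + 3 ≤ P.N) :
    Tword P (List.range' (P.N - 1 - n) n) (Z P 0) = Z P n := by
  induction n with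
  | zero => rfl
  | succ n ih =>
    rw [List.range'_succ, Tword_cons]
    have e : P.N - 1 - (n + 1) + 1 = P.N - 1 - n := by omega
    rw [e, ih (by omega), ← T_Z (by omega), show P.N - 1 - (n + 1) = P.N - 2 - n by omega]

theorem Tword_sigma_fix {i : ℕ} (hi : 3 ≤ i) (hi' : i + 1 ≤ P.N) :
    Tword P (sigmaWord P.N i) (E P (node P 1)) = E P (node P 1) := by
  have key : ∀ w : List ℕ, (∀ k ∈ w, 3 ≤ k ∧ k ≤ P.N) →
      Tword P w (E P (node P 1)) = E P (node P 1) := by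
    intro w hw
    induction w with
    | nil => rfl
    | cons k w ih =>
      rw [Tword_cons, ih fun l hl => hw l (by simp [hl])]
      have := hw k (by simp)
      apply T_far
      rw [A_node (by omega) (by omega) (by omega) (by omega), if_neg (by omega), if_neg (by omega)]
  apply key
  intro k hk
  simp only [sigmaWord, List.mem_append, List.mem_reverse, List.mem_range'_1, List.mem_cons,
    List.not_mem_nil, or_false] at hk
  omega

theorem Tword_wX : Tword P (wXWord P.N) (E P (node P 1)) = Z P (P.N - 3) := by
  have h3 := P.three_le
  have e : P.N - 2 = P.N - 3 + 1 := by omega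
  rw [wXWord, e, List.range'_succ, List.flatMap_cons, Tword_append]
  have key : ∀ w : List ℕ, (∀ k ∈ w, 3 ≤ k ∧ k + 1 ≤ P.N) →
      Tword P (w.flatMap (sigmaWord P.N)) (E P (node P 1)) = E P (node P 1) := by
    intro w hw
    induction w with
    | nil => rfl
    | cons k w ih =>
      have := hw k (by simp)
      rw [List.flatMap_cons, Tword_append, ih fun l hl => hw l (by simp [hl]),
        Tword_sigma_fix this.1 this.2]
  rw [key _ (by intro k hk; rw [List.mem_range'_1] at hk; omega), sigmaWord, Tword_append,
    Tword_append, show P.N - 1 - 2 = P.N - 3 by omega, Tword_down (by omega), Tword_cons,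
    Tword_cons, Tword_nil, T_Y le_rfl (.inr ⟨rfl, by omega⟩), map_qComm]
  have hA : P.A (node P (P.N - 1)) (node P P.N) = 0 := by
    rw [A_node (by omega) (by omega) (by omega) (by omega), if_neg (by omega), if_neg (by omega)]
  rw [T_far hA]
  have e2 : T P (node P (P.N - 1)) (Y P (P.N - 3)) = Y P (P.N - 2) := by
    have := T_Y_succ (P := P) (m := P.N - 3) (by omega)
    rwa [show P.N - 3 + 2 = P.N - 1 by omega, show P.N - 3 + 1 = P.N - 2 by omega] at this
  rw [e2]
  have := Tword_up (P := P) (n := P.N - 3) (by omega)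
  rwa [show P.N - 1 - (P.N - 3) = 2 by omega] at this

theorem hasWt_Y {m : ℕ} (hm : m + 1 < P.N) : HasWt P (Y P m) (fun j =>
    if j.val + 1 = P.N then (if m + 3 = P.N ∨ m + 2 = P.N then -1 else 0) else
    (if j.val = 0 then 1 else 0) + (if m = j.val then 1 else 0) +
      (if m + 1 = j.val then -1 else 0)) := by
  have h3 := P.three_le
  induction m with
  | zero =>
    refine (hasWt_E (node P 1)).congr fun j => ?_
    have := j.isLt
    rw [A_val, node_val (by omega) (by omega)]
    split_ifs <;>
      first | contradiction | omega | (simp only [false_and, false_or] at *; omega)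
  | succ m ih =>
    refine ((hasWt_E (node P (m + 2))).qComm (ih (by omega)) P.q⁻¹).congr fun j => ?_
    have := j.isLt
    rw [A_val, node_val (by omega) (by omega)]
    split_ifs <;>
      first | contradiction | omega

theorem hasWt_Z {n : ℕ} (hn : n + 3 ≤ P.N) : HasWt P (Z P n) (fun j =>
    if j.val + 1 = P.N then (if n = 0 then 1 else 0) else
    (if j.val = 0 then 1 else 0) + (if n + 2 + j.val = P.N then 1 else 0) +
      (if n + 3 + j.val = P.N then -1 else 0)) := by
  have h3 := P.three_le
  induction n with
  | zero =>
    refine ((hasWt_E (node P P.N)).qComm (hasWt_Y (by omega)) P.q⁻¹).congr fun j => ?_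
    have := j.isLt
    rw [A_val, node_val (by omega) (by omega)]
    split_ifs <;>
      first | contradiction | omega
  | succ n ih =>
    rw [Z_succ (by omega)]
    refine ((hasWt_E (node P (P.N - 2 - n))).qComm (ih (by omega)) P.q⁻¹).congr fun j => ?_
    have := j.isLt
    rw [A_val, node_val (by omega) (by omega)]
    split_ifs <;>
      first | contradiction | omega

variable (P)

/-- The image of `S ⊗ U_q` in `U_q ⊗ U_q` for a subalgebra `S` of `U_q`. -/
def leftTensor (S : Subalgebra 𝕜 (Uq P)) : Subalgebra 𝕜 (Uq P ⊗[𝕜] Uq P) :=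
  (Algebra.TensorProduct.map S.val (AlgHom.id 𝕜 (Uq P))).range

variable {P}

theorem tmul_mem_leftTensor {S : Subalgebra 𝕜 (Uq P)} {x : Uq P} (hx : x ∈ S) (y : Uq P) :
    x ⊗ₜ[𝕜] y ∈ leftTensor P S := ⟨(⟨x, hx⟩ : S) ⊗ₜ y, by simp⟩

theorem leftTensor_mono {S S' : Subalgebra 𝕜 (Uq P)} (h : S ≤ S') :
    leftTensor P S ≤ leftTensor P S' := by
  rintro _ ⟨x, rfl⟩
  induction x with
  | zero => simp
  | add x y hx hy => simpa using add_mem hx hy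
  | tmul x y => simpa using tmul_mem_leftTensor (h x.2) y

/-- `Δ(x) - x ⊗ 1` lies in `M_X K_1 ⊗ U_q`. -/
def Good (x : Uq P) : Prop :=
  (comul P x - x ⊗ₜ 1) * (Kinv P (node P 1) ⊗ₜ 1) ∈ leftTensor P (MX P)

theorem mem_MX {j : Fin P.N} (hj : j.val ≠ 0) :
    E P j ∈ MX P ∧ F P j ∈ MX P ∧ K P j ∈ MX P ∧ Kinv P j ∈ MX P :=
  ⟨Algebra.subset_adjoin ⟨j, hj, by simp⟩, Algebra.subset_adjoin ⟨j, hj, by simp⟩,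
    Algebra.subset_adjoin ⟨j, hj, by simp⟩, Algebra.subset_adjoin ⟨j, hj, by simp⟩⟩

@[simp] theorem comul_E (j : Fin P.N) : comul P (E P j) = E P j ⊗ₜ 1 + K P j ⊗ₜ E P j := by
  simp [comul]
@[simp] theorem comul_F (j : Fin P.N) : comul P (F P j) = F P j ⊗ₜ Kinv P j + 1 ⊗ₜ F P j := by
  simp [comul]
@[simp] theorem comul_K (j : Fin P.N) : comul P (K P j) = K P j ⊗ₜ K P j := by simp [comul]
@[simp] theorem comul_Kinv (j : Fin P.N) : comul P (Kinv P j) = Kinv P j ⊗ₜ Kinv P j := by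
  simp [comul]

theorem good_E : Good (E P (node P 1)) := by
  unfold Good
  rw [comul_E, add_sub_cancel_left, Algebra.TensorProduct.tmul_mul_tmul, (isRel P).K_Kinv]
  exact tmul_mem_leftTensor (one_mem _) _

theorem Good.qComm {x : Uq P} (hx : Good x) {j : Fin P.N} (hj : j.val ≠ 0) {μ} (hμ : HasWt P x μ)
    (hμj : μ j = -1) : Good (qComm P.q⁻¹ (E P j) x) := by
  have hm := mem_MX hj
  have hw := hμ j
  rw [hμj, zpow_neg_one] at hw
  have hE : E P j ⊗ₜ[𝕜] (1 : Uq P) ∈ leftTensor P (MX P) := tmul_mem_leftTensor hm.1 _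
  have hK : K P j ⊗ₜ[𝕜] E P j ∈ leftTensor P (MX P) := tmul_mem_leftTensor hm.2.2.1 _
  unfold Good at hx ⊢
  rw [map_qComm, comul_E]
  obtain ⟨z, hz⟩ : ∃ z, comul P x = x ⊗ₜ 1 + z := ⟨comul P x - x ⊗ₜ 1, by abel⟩
  rw [hz, add_sub_cancel_left] at hx
  rw [hz]
  have e1 : E P j * Kinv P (node P 1) = P.q ^ P.A (node P 1) j • (Kinv P (node P 1) * E P j) := by
    rw [(isRel P).Kinv_E, smul_smul, ← zpow_add₀ P.q_ne_zero, add_neg_cancel, zpow_zero, one_smul]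
  have e2 : K P j * Kinv P (node P 1) = Kinv P (node P 1) * K P j :=
    ((isRel P).Kinv_K' _ _).symm
  have key : (QSP.qComm P.q⁻¹ (E P j ⊗ₜ 1 + K P j ⊗ₜ E P j) (x ⊗ₜ 1 + z)
        - QSP.qComm P.q⁻¹ (E P j) x ⊗ₜ 1) * (Kinv P (node P 1) ⊗ₜ[𝕜] (1 : Uq P))
      = (E P j ⊗ₜ 1 + K P j ⊗ₜ E P j) * (z * (Kinv P (node P 1) ⊗ₜ[𝕜] (1 : Uq P)))
        - P.q⁻¹ • ((z * (Kinv P (node P 1) ⊗ₜ[𝕜] (1 : Uq P))) *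
          (P.q ^ P.A (node P 1) j • (E P j ⊗ₜ 1) + K P j ⊗ₜ E P j)) := by
    have c1 : (E P j ⊗ₜ[𝕜] (1 : Uq P)) * (Kinv P (node P 1) ⊗ₜ[𝕜] (1 : Uq P)) =
        P.q ^ P.A (node P 1) j • ((Kinv P (node P 1) ⊗ₜ[𝕜] (1 : Uq P)) * (E P j ⊗ₜ[𝕜] 1)) := by
      rw [Algebra.TensorProduct.tmul_mul_tmul, e1, Algebra.TensorProduct.tmul_mul_tmul, smul_tmul']
    have c2 : (K P j ⊗ₜ[𝕜] E P j) * (Kinv P (node P 1) ⊗ₜ[𝕜] (1 : Uq P)) =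
        (Kinv P (node P 1) ⊗ₜ[𝕜] (1 : Uq P)) * (K P j ⊗ₜ[𝕜] E P j) := by
      rw [Algebra.TensorProduct.tmul_mul_tmul, e2, Algebra.TensorProduct.tmul_mul_tmul, mul_one,
        one_mul]
    have c3 : (K P j ⊗ₜ[𝕜] E P j) * (x ⊗ₜ[𝕜] (1 : Uq P)) =
        P.q⁻¹ • ((x ⊗ₜ[𝕜] (1 : Uq P)) * (K P j ⊗ₜ[𝕜] E P j)) := by
      rw [Algebra.TensorProduct.tmul_mul_tmul, hw, Algebra.TensorProduct.tmul_mul_tmul, smul_tmul',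
        one_mul, mul_one]
    have c4 : QSP.qComm P.q⁻¹ (E P j) x ⊗ₜ[𝕜] (1 : Uq P) =
        QSP.qComm P.q⁻¹ (E P j ⊗ₜ[𝕜] (1 : Uq P)) (x ⊗ₜ[𝕜] (1 : Uq P)) := by
      simp only [QSP.qComm, sub_tmul, ← smul_tmul', Algebra.TensorProduct.tmul_mul_tmul, one_mul]
    rw [c4]
    unfold QSP.qComm
    simp only [mul_add, add_mul, c3]
    simp only [mul_add, add_mul, mul_sub, sub_mul, smul_mul_assoc, mul_smul_comm, mul_assoc, c1, c2,
      smul_add, smul_sub]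
    abel
  rw [key]
  exact sub_mem (mul_mem (add_mem hE hK) hx)
    (Subalgebra.smul_mem _ (mul_mem hx (add_mem (Subalgebra.smul_mem _ hE _) hK)) _)

theorem good_Y {m : ℕ} (hm : m + 1 < P.N) : Good (Y P m) := by
  induction m with
  | zero => exact good_E
  | succ m ih =>
    have hv := node_val (P := P) (k := m + 2) (by omega) (by omega)
    refine (ih (by omega)).qComm (by omega) (hasWt_Y (by omega)) ?_
    rw [hv]
    split_ifs <;> omega

theorem good_Z {n : ℕ} (hn : n + 3 ≤ P.N) : Good (Z P n) := by
  induction n with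
  | zero =>
    have hv := node_val (P := P) (k := P.N) (by omega) (by omega)
    refine (good_Y (by omega)).qComm (by omega) (hasWt_Y (by omega)) ?_
    rw [hv]
    split_ifs <;> omega
  | succ n ih =>
    have hv := node_val (P := P) (k := P.N - 2 - n) (by omega) (by omega)
    rw [Z_succ (by omega)]
    refine (ih (by omega)).qComm (by omega) (hasWt_Z (by omega)) ?_
    rw [hv]
    split_ifs <;> omega

theorem MX_le_Bc (c : 𝕜) : MX P ≤ Bc P c := fun _ hx =>
  Algebra.subset_adjoin (Set.mem_union_left _ hx)

theorem B1_mem (c : 𝕜) : B1 P c ∈ Bc P c := Algebra.subset_adjoin (Set.mem_union_right _ rfl)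

theorem comul_MX {x : Uq P} (hx : x ∈ MX P) : comul P x ∈ leftTensor P (MX P) := by
  have : MX P ≤ (leftTensor P (MX P)).comap (comul P) := by
    refine Algebra.adjoin_le ?_
    rintro _ ⟨j, hj, rfl | rfl | rfl | rfl⟩
    · have h : comul P (E P j) ∈ leftTensor P (MX P) := by
        rw [comul_E]
        exact add_mem (tmul_mem_leftTensor (mem_MX hj).1 _)
          (tmul_mem_leftTensor (mem_MX hj).2.2.1 _)
      exact h
    · have h : comul P (F P j) ∈ leftTensor P (MX P) := by
        rw [comul_F]
        exact add_mem (tmul_mem_leftTensor (mem_MX hj).2.1 _)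
          (tmul_mem_leftTensor (one_mem _) _)
      exact h
    · have h : comul P (K P j) ∈ leftTensor P (MX P) := by
        rw [comul_K]
        exact tmul_mem_leftTensor (mem_MX hj).2.2.1 _
      exact h
    · have h : comul P (Kinv P j) ∈ leftTensor P (MX P) := by
        rw [comul_Kinv]
        exact tmul_mem_leftTensor (mem_MX hj).2.2.2 _
      exact h
  exact this hx

/-- `B_c` is a coideal subalgebra: `Δ(B_c) ⊆ B_c ⊗ U_q`. -/
theorem comul_Bc (c : 𝕜) {x : Uq P} (hx : x ∈ Bc P c) : comul P x ∈ leftTensor P (Bc P c) := by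
  have : Bc P c ≤ (leftTensor P (Bc P c)).comap (comul P) := by
    refine Algebra.adjoin_le ?_
    rintro y (hy | hy)
    · exact leftTensor_mono (MX_le_Bc c) (comul_MX hy)
    · obtain rfl : y = B1 P c := hy
      change comul P (B1 P c) ∈ leftTensor P (Bc P c)
      have hg : Good (Z P (P.N - 3)) := good_Z (by have := P.three_le; omega)
      have hB := B1_mem (P := P) c
      have hB1 : B1 P c = F P (node P 1) - c • (Z P (P.N - 3) * Kinv P (node P 1)) := by
        rw [B1, Tword_wX]
      unfold Good at hg
      obtain ⟨z, hz⟩ : ∃ z, comul P (Z P (P.N - 3)) = Z P (P.N - 3) ⊗ₜ 1 + z :=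
        ⟨comul P (Z P (P.N - 3)) - Z P (P.N - 3) ⊗ₜ 1, by abel⟩
      rw [hz, add_sub_cancel_left] at hg
      have key : comul P (B1 P c) = B1 P c ⊗ₜ Kinv P (node P 1) + 1 ⊗ₜ F P (node P 1)
          - c • (z * (Kinv P (node P 1) ⊗ₜ 1) * (1 ⊗ₜ Kinv P (node P 1))) := by
        rw [hB1, map_sub, map_smul, map_mul, comul_F, comul_Kinv, hz, mul_assoc z,
          Algebra.TensorProduct.tmul_mul_tmul, mul_one, one_mul, sub_tmul, add_mul,
          Algebra.TensorProduct.tmul_mul_tmul, one_mul, ← smul_tmul', smul_add]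
        abel
      rw [key]
      exact sub_mem (add_mem (tmul_mem_leftTensor hB _) (tmul_mem_leftTensor (one_mem _) _))
        (Subalgebra.smul_mem _ (mul_mem (leftTensor_mono (MX_le_Bc c) hg)
          (tmul_mem_leftTensor (one_mem _) _)) _)
  exact this hx

end Coideal

/-! ### Weights, types and tensor products -/

noncomputable section

section Weights
open TensorProduct
variable (P : Params 𝕜)

/-- `K_i` as a unit. -/
def Ku (i : Fin P.N) : (Uq P)ˣ := ⟨K P i, Kinv P i, (isRel P).K_Kinv i, (isRel P).Kinv_K i⟩

/-- `K_h = ∏ K_i ^ n_i` for `h = ∑ n_i h_{α_i}` in the coroot lattice of `so(2N)`. -/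
def Kh (h : Fin P.N → ℤ) : Uq P := ((List.ofFn fun i => Ku P i ^ h i).prod : (Uq P)ˣ)

/-- The coroot lattice of `so(2N-1)`. The element `h` stands for `∑ h_a h_{γ_{a+1}}`, where
`γ_1, …, γ_{N-1}` are the simple roots and `γ_{N-1}` is the short one. -/
abbrev CorootLattice : Type := Fin (P.N - 1) → ℤ

/-- The weight lattice `Hom(Q^∨, ℤ)` of `so(2N-1)`. -/
abbrev WeightLattice : Type := CorootLattice P →+ ℤ

/-- The group `Hom(Q^∨, {±1})`. -/
abbrev SignChar : Type := Multiplicative (CorootLattice P) →* ℤˣ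

/-- The value of a sign character as an element of the field. -/
def SignChar.val {P : Params 𝕜} (χ : SignChar P) (h : CorootLattice P) : 𝕜 :=
  (((χ (Multiplicative.ofAdd h) : ℤˣ) : ℤ) : 𝕜)

/-- The image of `h_{γ_{a+1}}` in the coroot lattice of `so(2N)`: it is `h_{α_{a+2}}` if
`a + 1 < N - 1` and `h_{α_N} - h_{α_{N-1}}` if `a + 1 = N - 1`. -/
def etaBasis (a : Fin (P.N - 1)) : Fin P.N → ℤ := fun j =>
  if j.val = a.val + 1 then 1 else if a.val + 2 = P.N ∧ j.val = a.val then -1 else 0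

/-- The group homomorphism `η` from the coroot lattice of `so(2N-1)` to that of `so(2N)`. -/
def eta : CorootLattice P →+ (Fin P.N → ℤ) where
  toFun h := ∑ a, h a • etaBasis P a
  map_zero' := by simp
  map_add' h h' := by simp [add_smul, Finset.sum_add_distrib]

variable {P}

theorem eta_zero (h : CorootLattice P) (j : Fin P.N) (hj : j.val = 0) : eta P h j = 0 := by
  have := P.three_le
  simp only [eta, AddMonoidHom.coe_mk, ZeroHom.coe_mk, Finset.sum_apply, Pi.smul_apply]
  refine Finset.sum_eq_zero fun a _ => ?_
  have : etaBasis P a j = 0 := by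
    unfold etaBasis
    rw [if_neg (by omega), if_neg (by omega)]
  rw [this, smul_zero]

theorem Ku_zpow_mem {j : Fin P.N} (hj : j.val ≠ 0) (n : ℤ) :
    ((Ku P j ^ n : (Uq P)ˣ) : Uq P) ∈ MX P := by
  have hm := mem_MX hj
  cases n with
  | ofNat n =>
    rw [Int.ofNat_eq_natCast, zpow_natCast, Units.val_pow_eq_pow_val]
    exact pow_mem hm.2.2.1 n
  | negSucc n =>
    rw [zpow_negSucc, ← inv_pow, Units.val_pow_eq_pow_val]
    exact pow_mem hm.2.2.2 _

theorem Kh_mem (h : Fin P.N → ℤ) (h0 : ∀ j : Fin P.N, j.val = 0 → h j = 0) : Kh P h ∈ MX P := by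
  have key : ∀ L : List (Uq P)ˣ, (∀ u ∈ L, (u : Uq P) ∈ MX P) → (L.prod : Uq P) ∈ MX P := by
    intro L hL
    induction L with
    | nil => exact one_mem _
    | cons u L ih =>
      rw [List.prod_cons, Units.val_mul]
      exact mul_mem (hL u (by simp)) (ih fun v hv => hL v (by simp [hv]))
  refine key _ fun u hu => ?_
  obtain ⟨j, rfl⟩ := (List.mem_ofFn' _ _).1 hu
  by_cases hj : j.val = 0
  · beta_reduce; rw [h0 j hj, zpow_zero]; exact one_mem _
  · exact Ku_zpow_mem hj _

variable (P)

/-- The element `K_{η(h)}` of `B_c`. -/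
def Keta (c : 𝕜) (h : CorootLattice P) : Bc P c :=
  ⟨Kh P (eta P h), MX_le_Bc c (Kh_mem _ (eta_zero h))⟩

section Types
variable (c : 𝕜) (χ : SignChar P) (V : Type*) [AddCommGroup V] [Module 𝕜 V] [Module (Bc P c) V]
  [IsScalarTower 𝕜 (Bc P c) V]

instance : SMulCommClass (Bc P c) 𝕜 V := IsScalarTower.to_smulCommClass'

/-- The weight space `V_{λ,χ}`. -/
def weightSpace (lam : WeightLattice P) : Submodule 𝕜 V where
  carrier := {v | ∀ h, Keta P c h • v = (χ.val h * P.q ^ lam h) • v}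
  zero_mem' h := by simp
  add_mem' hv hw h := by rw [smul_add, smul_add, hv h, hw h]
  smul_mem' r v hv h := by rw [smul_comm, hv h, smul_comm]

/-- The submodule `V^χ`, the sum of all `V_{λ,χ}`. -/
def typeSpace : Submodule 𝕜 V := ⨆ lam : WeightLattice P, weightSpace P c χ V lam

/-- `V` is of type `χ` if `V = V^χ`. -/
def IsOfType : Prop := typeSpace P c χ V = ⊤
end Types

/-- The coaction `B_c → B_c ⊗ U_q`, the restriction of the coproduct. -/
def coaction (c : 𝕜) : Bc P c →ₐ[𝕜] Bc P c ⊗[𝕜] Uq P :=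
  (AlgEquiv.ofInjective (Algebra.TensorProduct.map (Bc P c).val (AlgHom.id 𝕜 (Uq P)))
    (Module.Flat.rTensor_preserves_injective_linearMap (M := Uq P) (Bc P c).val.toLinearMap
      Subtype.val_injective)).symm.toAlgHom.comp
  (((comul P).comp (Bc P c).val).codRestrict (leftTensor P (Bc P c)) fun x => comul_Bc c x.2)

theorem map_coaction (c : 𝕜) (b : Bc P c) :
    Algebra.TensorProduct.map (Bc P c).val (AlgHom.id 𝕜 (Uq P)) (coaction P c b) =
      comul P (b : Uq P) := by
  have h := AlgEquiv.apply_symm_apply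
    (AlgEquiv.ofInjective (Algebra.TensorProduct.map (Bc P c).val (AlgHom.id 𝕜 (Uq P)))
    (Module.Flat.rTensor_preserves_injective_linearMap (M := Uq P) (Bc P c).val.toLinearMap
      Subtype.val_injective))
    ((((comul P).comp (Bc P c).val).codRestrict (leftTensor P (Bc P c)) fun x => comul_Bc c x.2) b)
  exact congrArg Subtype.val h

section Tensor
variable (c : 𝕜) (V : Type*) [AddCommGroup V] [Module 𝕜 V] [Module (Bc P c) V]
  [IsScalarTower 𝕜 (Bc P c) V] (W : Type*) [AddCommGroup W] [Module 𝕜 W] [Module (Uq P) W]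
  [IsScalarTower 𝕜 (Uq P) W]

/-- The action of `B_c ⊗ U_q` on `V ⊗ W` by `(b ⊗ u)(v ⊗ w) = bv ⊗ uw`. -/
def outerRep : Bc P c ⊗[𝕜] Uq P →ₐ[𝕜] Module.End 𝕜 (V ⊗[𝕜] W) :=
  (Module.endTensorEndAlgHom (R := 𝕜) (S := 𝕜) (A := 𝕜) (M := V) (N := W)).comp
    (Algebra.TensorProduct.map (Algebra.lsmul 𝕜 𝕜 V) (Algebra.lsmul 𝕜 𝕜 W))

/-- The action of `B_c` on `V ⊗ W` through the coproduct. -/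
def tensorRep : Bc P c →ₐ[𝕜] Module.End 𝕜 (V ⊗[𝕜] W) := (outerRep P c V W).comp (coaction P c)

/-- The vector space `V ⊗ W`, for a `B_c`-module `V` and a `U_q`-module `W`, as a `B_c`-module. -/
def TensorMod (_P : Params 𝕜) (_c : 𝕜) (V W : Type*) [AddCommGroup V] [Module 𝕜 V]
    [AddCommGroup W] [Module 𝕜 W] : Type _ := V ⊗[𝕜] W

instance : AddCommGroup (TensorMod P c V W) := inferInstanceAs (AddCommGroup (V ⊗[𝕜] W))
instance : Module 𝕜 (TensorMod P c V W) := inferInstanceAs (Module 𝕜 (V ⊗[𝕜] W))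
instance : Module (Bc P c) (TensorMod P c V W) :=
  Module.compHom (V ⊗[𝕜] W) (tensorRep P c V W).toRingHom

theorem tensor_smul_def (b : Bc P c) (x : TensorMod P c V W) :
    b • x = (tensorRep P c V W b : V ⊗[𝕜] W → V ⊗[𝕜] W) x := rfl

instance : IsScalarTower 𝕜 (Bc P c) (TensorMod P c V W) := ⟨fun r b x => by
  rw [tensor_smul_def, tensor_smul_def, map_smul]; rfl⟩

theorem outerRep_tmul (b : Bc P c) (u : Uq P) (v : V) (w : W) :
    outerRep P c V W (b ⊗ₜ u) (v ⊗ₜ w) = (b • v) ⊗ₜ (u • w) := rfl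

end Tensor

section OneDim
variable (χ : SignChar P)

/-- The element `ξ_j` of the coroot lattice of `so(2N-1)` with `η(ξ_j) = h_{α_j}` for the nodes
`j` with label in `{2, …, N}`, and `ξ_j = 0` for the node with label `1`. -/
def xi (j : Fin P.N) : CorootLattice P := fun a =>
  if a.val + 1 = j.val then 1 else if a.val + 2 = j.val ∧ j.val + 1 = P.N then 1 else 0

theorem SignChar.val_mul_self {P : Params 𝕜} (χ : SignChar P) (h : CorootLattice P) :
    χ.val h * χ.val h = 1 := by
  unfold SignChar.val
  rw [← Int.cast_mul, ← Units.val_mul, Int.units_mul_self]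
  simp

theorem isRel_char : IsRel P (R := 𝕜) (fun _ => 0) (fun _ => 0) (fun j => χ.val (xi P j))
    (fun j => χ.val (xi P j)) where
  K_Kinv i := χ.val_mul_self _
  Kinv_K i := χ.val_mul_self _
  K_K i j := mul_comm _ _
  K_E i j := by simp
  K_F i j := by simp
  E_F i j := by simp
  E_comm i j h := rfl
  E_serre i j h := by simp [serre]
  F_comm i j h := rfl
  F_serre i j h := by simp [serre]

/-- The character of `U_q` with `E_i, F_i ↦ 0`, `K_1 ↦ 1` and `K_{η(h)} ↦ χ(h)`. -/
def char : Uq P →ₐ[𝕜] 𝕜 := Uq.lift P (isRel_char P χ)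

/-- The one-dimensional `U_q`-module `F_χ`. -/
def OneDim (_χ : SignChar P) : Type u := 𝕜

instance : AddCommGroup (OneDim P χ) := inferInstanceAs (AddCommGroup 𝕜)
instance : Module 𝕜 (OneDim P χ) := inferInstanceAs (Module 𝕜 𝕜)
instance : Module.Finite 𝕜 (OneDim P χ) := inferInstanceAs (Module.Finite 𝕜 𝕜)
instance : Module (Uq P) (OneDim P χ) := Module.compHom 𝕜 (char P χ).toRingHom

theorem oneDim_smul (u : Uq P) (x : OneDim P χ) : u • x = char P χ u • x := rfl

instance : IsScalarTower 𝕜 (Uq P) (OneDim P χ) := ⟨fun r u x => by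
  rw [oneDim_smul, oneDim_smul, map_smul, smul_assoc]⟩

theorem xi_eta (h : CorootLattice P) : ∑ j, eta P h j • xi P j = h := by
  have h3 := P.three_le
  have key (a : Fin (P.N - 1)) : ∑ j, etaBasis P a j • xi P j = Pi.single a 1 := by
    funext b
    have ha := a.isLt
    have hb := b.isLt
    rw [Finset.sum_apply]
    by_cases hN : a.val + 2 = P.N
    · rw [Finset.sum_eq_add (⟨a + 1, by omega⟩ : Fin P.N) ⟨a, by omega⟩ (by simp)]
      · simp only [etaBasis, xi, Pi.smul_apply, Pi.single_apply, Fin.ext_iff, smul_eq_mul]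
        split_ifs <;> first | contradiction | omega | (simp only [and_true] at *; omega)
      · intro j _ hj
        simp only [ne_eq, Fin.ext_iff] at hj
        simp only [etaBasis, Pi.smul_apply]
        rw [if_neg (by omega), if_neg (by omega), zero_smul]
      · simp
      · simp
    · rw [Finset.sum_eq_single (⟨a + 1, by omega⟩ : Fin P.N)]
      · simp only [etaBasis, xi, Pi.smul_apply, Pi.single_apply, Fin.ext_iff, smul_eq_mul]
        split_ifs <;> omega
      · intro j _ hj
        simp only [ne_eq, Fin.ext_iff] at hj
        simp only [etaBasis, Pi.smul_apply]
        rw [if_neg (by omega), if_neg (by omega), zero_smul]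
      · simp
  simp only [eta, AddMonoidHom.coe_mk, ZeroHom.coe_mk, Finset.sum_apply, Pi.smul_apply,
    Finset.sum_smul, smul_assoc]
  rw [Finset.sum_comm]
  simp only [← Finset.smul_sum, key]
  funext b
  simp [Finset.sum_apply, Pi.single_apply]

/-- The sign character with values in `𝕜ˣ`. -/
def SignChar.unitHom {P : Params 𝕜} (χ : SignChar P) : Multiplicative (CorootLattice P) →* 𝕜ˣ :=
  (Units.map (Int.castRingHom 𝕜).toMonoidHom).comp χ

theorem SignChar.unitHom_val {P : Params 𝕜} (χ : SignChar P) (h : CorootLattice P) :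
    ((χ.unitHom (Multiplicative.ofAdd h) : 𝕜ˣ) : 𝕜) = χ.val h := rfl

theorem char_Kh (h : Fin P.N → ℤ) : char P χ (Kh P h) = χ.val (∑ j, h j • xi P j) := by
  have e : ∀ j, Units.map (char P χ).toMonoidHom (Ku P j) =
      χ.unitHom (Multiplicative.ofAdd (xi P j)) := by
    intro j
    ext
    change char P χ (K P j) = _
    rw [char, lift_K]
    rfl
  change ((Units.map (char P χ).toMonoidHom (List.ofFn fun i => Ku P i ^ h i).prod : 𝕜ˣ) : 𝕜) = _
  rw [map_list_prod, List.map_ofFn, ← SignChar.unitHom_val, ofAdd_sum, map_prod, List.prod_ofFn]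
  congr 1
  refine Finset.prod_congr rfl fun j _ => ?_
  rw [Function.comp_apply, map_zpow, e, ofAdd_zsmul, map_zpow]

/-- On `F_χ` the element `K_{η(h)}` acts by `χ(h)`. -/
theorem char_Keta (c : 𝕜) (h : CorootLattice P) : char P χ (Keta P c h : Uq P) = χ.val h := by
  rw [Keta, char_Kh, xi_eta]

end OneDim

theorem comul_Kh (h : Fin P.N → ℤ) : comul P (Kh P h) = Kh P h ⊗ₜ Kh P h := by
  have key : ∀ L : List (Uq P)ˣ, (∀ u ∈ L, comul P (u : Uq P) = (u : Uq P) ⊗ₜ (u : Uq P)) →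
      comul P (L.prod : Uq P) = (L.prod : Uq P) ⊗ₜ (L.prod : Uq P) := by
    intro L hL
    induction L with
    | nil => simp [Algebra.TensorProduct.one_def]
    | cons u L ih =>
      rw [List.prod_cons, Units.val_mul, map_mul, hL u (by simp),
        ih fun v hv => hL v (by simp [hv]), Algebra.TensorProduct.tmul_mul_tmul]
  refine key _ fun u hu => ?_
  obtain ⟨j, rfl⟩ := (List.mem_ofFn' _ _).1 hu
  beta_reduce
  cases h j with
  | ofNat n =>
    rw [Int.ofNat_eq_natCast, zpow_natCast, Units.val_pow_eq_pow_val, map_pow]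
    change comul P (K P j) ^ n = _
    rw [comul_K, Algebra.TensorProduct.tmul_pow]
    rfl
  | negSucc n =>
    rw [zpow_negSucc, ← inv_pow, Units.val_pow_eq_pow_val, map_pow]
    change comul P (Kinv P j) ^ (n + 1) = _
    rw [comul_Kinv, Algebra.TensorProduct.tmul_pow]
    rfl

theorem coaction_Keta (c : 𝕜) (h : CorootLattice P) :
    coaction P c (Keta P c h) = Keta P c h ⊗ₜ (Keta P c h : Uq P) := by
  apply Module.Flat.rTensor_preserves_injective_linearMap (M := Uq P) (Bc P c).val.toLinearMap
      Subtype.val_injective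
  change Algebra.TensorProduct.map (Bc P c).val (AlgHom.id 𝕜 (Uq P)) _ = _
  rw [map_coaction]
  exact comul_Kh P _

section Functor
variable (c : 𝕜) (χ : SignChar P)

/-- If `V` is of type `𝟏` then `V ⊗ F_χ` is of type `χ`. -/
theorem isOfType_tensor (V : Type*) [AddCommGroup V] [Module 𝕜 V] [Module (Bc P c) V]
    [IsScalarTower 𝕜 (Bc P c) V] (hV : IsOfType P c 1 V) :
    IsOfType P c χ (TensorMod P c V (OneDim P χ)) := by
  have key (w : OneDim P χ) : (⊤ : Submodule 𝕜 V) ≤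
      (typeSpace P c χ (TensorMod P c V (OneDim P χ))).comap
        ((TensorProduct.mk 𝕜 V (OneDim P χ)).flip w) := by
    rw [← hV]
    refine iSup_le fun lam v hv => ?_
    refine Submodule.mem_iSup_of_mem lam fun h => ?_
    change outerRep P c V (OneDim P χ) (coaction P c (Keta P c h)) (v ⊗ₜ w) =
      (χ.val h * P.q ^ lam h) • (v ⊗ₜ w)
    have h1 : (1 : SignChar P).val h = 1 := by simp [SignChar.val]
    rw [coaction_Keta, outerRep_tmul, hv h, oneDim_smul, char_Keta, h1, one_mul, smul_tmul_smul,
      mul_comm]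
    rfl
  refine eq_top_iff.2 fun x _ => ?_
  induction x using TensorProduct.induction_on with
  | zero => exact zero_mem _
  | add x y hx hy => exact add_mem (hx trivial) (hy trivial)
  | tmul v w => exact key w trivial

open CategoryTheory
open scoped ModuleCat

/-- The finite dimensional `B_c`-modules of type `χ`. -/
def finOfType : ObjectProperty (ModuleCat.{u} (Bc P c)) := fun V =>
  Module.Finite 𝕜 V ∧ IsOfType P c χ V

/-- The category of finite dimensional `B_c`-modules of type `χ`. -/
abbrev ModFin : Type (u + 1) := (finOfType P c χ).FullSubcategory

/-- `V ⊗ W` as an object, for a `B_c`-module `V` and a `U_q`-module `W`. -/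
def tensorObj (V : ModuleCat.{u} (Bc P c)) (W : Type u) [AddCommGroup W] [Module 𝕜 W]
    [Module (Uq P) W] [IsScalarTower 𝕜 (Uq P) W] : ModuleCat.{u} (Bc P c) :=
  ModuleCat.of (Bc P c) (TensorMod P c V W)

theorem outerRep_map {V V' : ModuleCat.{u} (Bc P c)} (f : V ⟶ V') (W : Type u) [AddCommGroup W]
    [Module 𝕜 W] [Module (Uq P) W] [IsScalarTower 𝕜 (Uq P) W] (t : Bc P c ⊗[𝕜] Uq P)
    (x : V ⊗[𝕜] W) :
    TensorProduct.map (f.hom.restrictScalars 𝕜) LinearMap.id (outerRep P c V W t x) =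
      outerRep P c V' W t (TensorProduct.map (f.hom.restrictScalars 𝕜) LinearMap.id x) := by
  induction t with
  | zero => simp
  | add t t' ht ht' => simp [ht, ht']
  | tmul b u =>
    induction x with
    | zero => simp
    | add x x' hx hx' => simp [hx, hx']
    | tmul v w => simp [outerRep_tmul]

/-- The map `f ⊗ id : V ⊗ W → V' ⊗ W` for a homomorphism `f` of `B_c`-modules. -/
def tensorMap {V V' : ModuleCat.{u} (Bc P c)} (f : V ⟶ V') (W : Type u) [AddCommGroup W]
    [Module 𝕜 W] [Module (Uq P) W] [IsScalarTower 𝕜 (Uq P) W] :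
    tensorObj P c V W ⟶ tensorObj P c V' W :=
  ModuleCat.ofHom
    { toFun := fun x => (TensorProduct.map (f.hom.restrictScalars 𝕜) LinearMap.id :
        V ⊗[𝕜] W →ₗ[𝕜] V' ⊗[𝕜] W) x
      map_add' := fun x y => map_add (TensorProduct.map (f.hom.restrictScalars 𝕜) LinearMap.id :
        V ⊗[𝕜] W →ₗ[𝕜] V' ⊗[𝕜] W) x y
      map_smul' := fun b x => outerRep_map P c f W (coaction P c b) x }

/-- The functor `V ↦ V ⊗ F_χ` on all `B_c`-modules. -/
def tensorOneDim : ModuleCat.{u} (Bc P c) ⥤ ModuleCat.{u} (Bc P c) where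
  obj V := tensorObj P c V (OneDim P χ)
  map f := tensorMap P c f (OneDim P χ)
  map_id V := by
    ext x
    exact congrArg (fun g : V ⊗[𝕜] OneDim P χ →ₗ[𝕜] V ⊗[𝕜] OneDim P χ => g x)
      (TensorProduct.map_id (R := 𝕜) (M := V) (N := OneDim P χ))
  map_comp {V V' V''} f g := by
    ext x
    exact congrArg (fun g : V ⊗[𝕜] OneDim P χ →ₗ[𝕜] V'' ⊗[𝕜] OneDim P χ => g x)
      (TensorProduct.map_comp (R := 𝕜) (g.hom.restrictScalars 𝕜)
        (LinearMap.id : OneDim P χ →ₗ[𝕜] OneDim P χ) (f.hom.restrictScalars 𝕜) LinearMap.id)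

/-- The `𝕜`-vector space structure obtained by restriction from `B_c` is the given one. -/
theorem module_eq (V : Type u) [AddCommGroup V] [m : Module 𝕜 V] [Module (Bc P c) V]
    [IsScalarTower 𝕜 (Bc P c) V] :
    (ModuleCat.moduleOfAlgebraModule (ModuleCat.of (Bc P c) V) : Module 𝕜 V) = m := by
  refine Module.ext' _ _ fun r v => ?_
  exact algebraMap_smul (Bc P c) r v

theorem finOfType_of (V : Type u) [AddCommGroup V] [m : Module 𝕜 V] [Module (Bc P c) V]
    [IsScalarTower 𝕜 (Bc P c) V] [Module.Finite 𝕜 V] (h : IsOfType P c χ V) :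
    finOfType P c χ (ModuleCat.of (Bc P c) V) := by
  have e := module_eq P c V
  subst e
  exact ⟨inferInstance, h⟩

/-- The functor `V ↦ V ⊗ F_χ` from finite dimensional `B_c`-modules of type `𝟏` to finite
dimensional `B_c`-modules of type `χ`. -/
def tensorFunctor : ModFin P c 1 ⥤ ModFin P c χ :=
  (finOfType P c χ).lift ((finOfType P c 1).ι ⋙ tensorOneDim P c χ) fun V => by
    have : Module.Finite 𝕜 V.obj := V.property.1
    have : Module.Finite 𝕜 (TensorMod P c V.obj (OneDim P χ)) :=
      inferInstanceAs (Module.Finite 𝕜 (V.obj ⊗[𝕜] OneDim P χ))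
    exact finOfType_of P c χ (TensorMod P c V.obj (OneDim P χ))
      (isOfType_tensor P c χ V.obj V.property.2)

end Functor
end Weights
end

end QSP

/-!
Contracting the second leg of the coaction `Δ : B_c → B_c ⊗ U_q` with the character of `F_χ` gives
an algebra endomorphism `twist P c χ` of `B_c`, and `V ⊗ F_χ` is the pullback of `V` along it
(`tensorOneDimIso`). The same contraction on `U_q` fixes `E_i` and multiplies `F_i`, `K_i` and
`K_i⁻¹` by the same sign `χ(ξ_i)`; hence it is an involution (`twistUq_twistUq`), and so is its
restriction `twist P c χ` to `B_c` (`twist_twist`). Thus `V ↦ V ⊗ F_χ` is an equivalence on all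
`B_c`-modules.

Since `twist P c χ` multiplies `K_{η(h)}` by the sign `χ(h)` (`twist_Keta`), pulling back along it
preserves dimension and exchanges the types `𝟏` and `χ` (`isOfType_one_pullback`), so the equivalence
restricts to the two subcategories.
-/

noncomputable section

namespace QSP

open TensorProduct CategoryTheory
open scoped ModuleCat

universe u
variable {𝕜 : Type u} [Field 𝕜]

theorem Uq.algHom_ext {P : Params 𝕜} {R : Type*} [Ring R] [Algebra 𝕜 R] {φ ψ : Uq P →ₐ[𝕜] R}
    (hE : ∀ i, φ (E P i) = ψ (E P i)) (hF : ∀ i, φ (F P i) = ψ (F P i))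
    (hK : ∀ i, φ (K P i) = ψ (K P i)) (hK' : ∀ i, φ (Kinv P i) = ψ (Kinv P i)) : φ = ψ := by
  refine RingQuot.ringQuot_ext' 𝕜 φ ψ (FreeAlgebra.hom_ext (funext fun g => ?_))
  cases g with
  | E i => exact hE i
  | F i => exact hF i
  | K i => exact hK i
  | Kinv i => exact hK' i

variable (P : Params 𝕜) (c : 𝕜) (χ : SignChar P)

/-- The contraction `a ⊗ u ↦ ε_χ(u) a` of the second tensor factor with the character `ε_χ` by
which `U_q` acts on `F_χ`. -/
def contract (A : Type*) [Ring A] [Algebra 𝕜 A] : A ⊗[𝕜] Uq P →ₐ[𝕜] A :=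
  (Algebra.TensorProduct.rid 𝕜 𝕜 A).toAlgHom.comp
    (Algebra.TensorProduct.map (AlgHom.id 𝕜 A) (char P χ))

@[simp] theorem contract_tmul {A : Type*} [Ring A] [Algebra 𝕜 A] (a : A) (u : Uq P) :
    contract P χ A (a ⊗ₜ u) = char P χ u • a := by
  simp [contract]

/-- The endomorphism `(id ⊗ ε_χ) ∘ Δ` of `U_q`, where `ε_χ` is the character of `F_χ`. -/
def twistUq : Uq P →ₐ[𝕜] Uq P := (contract P χ (Uq P)).comp (comul P)

/-- The endomorphism `(id ⊗ ε_χ) ∘ Δ` of `B_c`, where `ε_χ` is the character of `F_χ`. -/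
def twist : Bc P c →ₐ[𝕜] Bc P c := (contract P χ (Bc P c)).comp (coaction P c)

theorem twistUq_twistUq (x : Uq P) : twistUq P χ (twistUq P χ x) = x := by
  have h : (twistUq P χ).comp (twistUq P χ) = AlgHom.id 𝕜 (Uq P) := by
    apply Uq.algHom_ext <;> intro i <;>
      simp [twistUq, char, smul_smul, χ.val_mul_self]
  exact DFunLike.congr_fun h x

theorem coe_twist (b : Bc P c) : (twist P c χ b : Uq P) = twistUq P χ b := by
  change _ = contract P χ (Uq P) (comul P b)
  rw [← map_coaction]
  change ((contract P χ (Bc P c) (coaction P c b) : Bc P c) : Uq P) = _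
  induction coaction P c b with
  | zero => simp
  | add x y hx hy => simp [hx, hy]
  | tmul b u => simp

theorem twist_twist (b : Bc P c) : twist P c χ (twist P c χ b) = b :=
  Subtype.ext (by rw [coe_twist, coe_twist, twistUq_twistUq])

/-- The involution of `B_c` whose pullback is the functor `V ↦ V ⊗ F_χ`. -/
def twistEquiv : Bc P c ≃+* Bc P c where
  __ := twist P c χ
  invFun := twist P c χ
  left_inv := twist_twist P c χ
  right_inv := twist_twist P c χ

/-- The pullback of `B_c`-modules along the twist. -/
def pullback : ModuleCat.{u} (Bc P c) ⥤ ModuleCat.{u} (Bc P c) :=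
  ModuleCat.restrictScalars (twistEquiv P c χ).toRingHom

theorem twist_Keta (h : CorootLattice P) :
    twist P c χ (Keta P c h) = χ.val h • Keta P c h := by
  change contract P χ (Bc P c) (coaction P c (Keta P c h)) = _
  rw [coaction_Keta, contract_tmul, char_Keta]

/-- `F_χ` acts through its character only, so `B_c` acts on `V ⊗ F_χ` through the twist. -/
theorem smul_tensor_oneDim (V : Type*) [AddCommGroup V] [Module 𝕜 V] [Module (Bc P c) V]
    [IsScalarTower 𝕜 (Bc P c) V] (b : Bc P c) (v : V) (a : OneDim P χ) :
    outerRep P c V (OneDim P χ) (coaction P c b) (v ⊗ₜ a) = (twist P c χ b • v) ⊗ₜ a := by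
  change _ = (contract P χ (Bc P c) (coaction P c b) • v) ⊗ₜ[𝕜] a
  induction coaction P c b with
  | zero => simp
  | add x y hx hy => simp [hx, hy, add_smul, add_tmul]
  | tmul b u =>
    rw [outerRep_tmul, contract_tmul, oneDim_smul, tmul_smul, smul_assoc, smul_tmul']

/-- An additive bijection compatible with the scalars, as an isomorphism of modules. -/
def moduleIsoOfAddEquiv {A : Type*} [Ring A] {M N : ModuleCat.{u} A} (e : M ≃+ N)
    (h : ∀ (a : A) (x : M), e (a • x) = a • e x) : M ≅ N :=
  LinearEquiv.toModuleIso (X₁ := M) (X₂ := N) { e with map_smul' := h }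

/-- The linear isomorphism `v ⊗ a ↦ a v` from `V ⊗ F_χ` to `V`. -/
def oneDimRid (V : Type*) [AddCommGroup V] [Module 𝕜 V] : V ⊗[𝕜] OneDim P χ ≃ₗ[𝕜] V :=
  (TensorProduct.rid 𝕜 V : V ⊗[𝕜] 𝕜 ≃ₗ[𝕜] V)

theorem oneDimRid_tmul (V : Type*) [AddCommGroup V] [Module 𝕜 V] (v : V) (a : OneDim P χ) :
    oneDimRid P χ V (v ⊗ₜ a) = (show 𝕜 from a) • v := rfl

/-- The map `v ⊗ a ↦ a v` as an isomorphism from `V ⊗ F_χ` to the pullback of `V` along the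
twist. -/
def tensorObjIso (V : ModuleCat.{u} (Bc P c)) :
    tensorObj P c V (OneDim P χ) ≅ (pullback P c χ).obj V :=
  moduleIsoOfAddEquiv (oneDimRid P χ V).toAddEquiv fun b x => by
    change oneDimRid P χ V (outerRep P c V (OneDim P χ) (coaction P c b) x) =
      twist P c χ b • oneDimRid P χ V x
    induction x using TensorProduct.induction_on with
    | zero => simp
    | add x y hx hy => rw [map_add, map_add, hx, hy, map_add, smul_add]
    | tmul v a => rw [smul_tensor_oneDim, oneDimRid_tmul, oneDimRid_tmul, smul_comm]

/-- The functor `V ↦ V ⊗ F_χ` is the pullback along the twist. -/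
def tensorOneDimIso : tensorOneDim P c χ ≅ pullback P c χ :=
  NatIso.ofComponents (tensorObjIso P c χ) fun {V V'} f => by
    ext x
    change oneDimRid P χ V' (TensorProduct.map (f.hom.restrictScalars 𝕜) LinearMap.id x) =
      f.hom.restrictScalars 𝕜 (oneDimRid P χ V x)
    induction x using TensorProduct.induction_on with
    | zero => simp
    | add x y hx hy => rw [map_add, map_add, hx, hy, map_add, map_add]
    | tmul v a =>
      rw [TensorProduct.map_tmul, oneDimRid_tmul, oneDimRid_tmul, map_smul, LinearMap.id_apply]

/-- Pulling back twice along the twist gives the module back, because the twist is an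
involution. -/
def pullbackPullbackIso (V : ModuleCat.{u} (Bc P c)) :
    (pullback P c χ).obj ((pullback P c χ).obj V) ≅ V :=
  moduleIsoOfAddEquiv (AddEquiv.refl V) fun b v => by
    change twist P c χ (twist P c χ b) • (show V from v) = b • (show V from v)
    rw [twist_twist]

instance isEquivalence_pullback : (pullback P c χ).IsEquivalence :=
  (ModuleCat.restrictScalarsEquivalenceOfRingEquiv (twistEquiv P c χ)).isEquivalence_functor

instance isEquivalence_tensorOneDim : (tensorOneDim P c χ).IsEquivalence :=
  Functor.isEquivalence_of_iso (tensorOneDimIso P c χ).symm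

/-- The twist is `𝕜`-linear, so pulling back along it does not change the `𝕜`-vector space. -/
def pullbackLinearEquiv (V : ModuleCat.{u} (Bc P c)) :
    V ≃ₗ[𝕜] (pullback P c χ).obj V :=
  let e : V ≃+ (pullback P c χ).obj V := AddEquiv.refl V
  { e with
    map_smul' := fun r v => by
      change algebraMap 𝕜 (Bc P c) r • v = twist P c χ (algebraMap 𝕜 (Bc P c) r) • v
      rw [AlgHom.commutes] }

/-- The sign by which the twist multiplies `K_{η(h)}` cancels the one in the definition of
type `χ`. -/
theorem isOfType_one_pullback (V : ModuleCat.{u} (Bc P c)) (hV : IsOfType P c χ V) :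
    IsOfType P c 1 ((pullback P c χ).obj V) := by
  have key : (⊤ : Submodule 𝕜 V) ≤ (typeSpace P c 1 ((pullback P c χ).obj V)).comap
      (pullbackLinearEquiv P c χ V).toLinearMap := by
    rw [← hV]
    refine iSup_le fun lam v hv => Submodule.mem_comap.2 ?_
    refine Submodule.mem_iSup_of_mem lam fun h => ?_
    have e : twist P c χ (Keta P c h) • v = ((1 : SignChar P).val h * P.q ^ lam h) • v := by
      have h1 : (1 : SignChar P).val h = 1 := by simp [SignChar.val]
      rw [twist_Keta, smul_assoc, hv h, smul_smul, ← mul_assoc, χ.val_mul_self, h1]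
    exact e.trans ((pullbackLinearEquiv P c χ V).map_smul _ v)
  exact eq_top_iff.2 fun v _ => key (x := v) trivial

instance full_tensorFunctor : (tensorFunctor P c χ).Full :=
  have : ((finOfType P c 1).ι ⋙ tensorOneDim P c χ).Full := Functor.Full.comp _ _
  Functor.Full.of_comp_faithful_iso
    ((finOfType P c χ).liftCompιIso ((finOfType P c 1).ι ⋙ tensorOneDim P c χ) _)

instance faithful_tensorFunctor : (tensorFunctor P c χ).Faithful :=
  have : ((finOfType P c 1).ι ⋙ tensorOneDim P c χ).Faithful := Functor.Faithful.comp _ _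
  Functor.Faithful.of_comp_iso
    ((finOfType P c χ).liftCompιIso ((finOfType P c 1).ι ⋙ tensorOneDim P c χ) _)

instance essSurj_tensorFunctor : (tensorFunctor P c χ).EssSurj where
  mem_essImage W := by
    have : Module.Finite 𝕜 W.obj := W.property.1
    refine ⟨⟨(pullback P c χ).obj W.obj, Module.Finite.equiv (pullbackLinearEquiv P c χ W.obj),
      isOfType_one_pullback P c χ W.obj W.property.2⟩, ⟨(finOfType P c χ).isoMk ?_⟩⟩
    exact tensorObjIso P c χ ((pullback P c χ).obj W.obj) ≪≫ pullbackPullbackIso P c χ W.obj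

end QSP

end

/-- Let `𝕜` be a field of characteristic different from `2`, let `q ∈ 𝕜` be nonzero and not a root
of unity, and let `N ≥ 3` (the data `P`). Let `c ≠ 0` and let `χ` be a homomorphism from the coroot
lattice of `so(2N-1)` to `{±1}`. Then `V ↦ V ⊗ F_χ` is an equivalence from the category of finite
dimensional `B_c`-modules of type `𝟏` to the category of finite dimensional `B_c`-modules of
type `χ`. -/
theorem mainTheorem8 {𝕜 : Type*} [Field 𝕜] (hchar : ringChar 𝕜 ≠ 2) (P : QSP.Params 𝕜) (c : 𝕜)
    (hc : c ≠ 0) (χ : QSP.SignChar P) : (QSP.tensorFunctor P c χ).IsEquivalence where
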